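/- **Setting.** Let $\{X_t\}$ and $\{W_t\}$ be independent Markov chains with measurable state spaces $E_1,E_2\subseteq\mathbb R$ and transition probabilities $P_1,P_2$. For $i=1,2$ let $P_i$ be irreducible with respect to a nontrivial measure $\phi_i$ and satisfy the minorization $P_i\ge s_i\otimes\nu_i$, where $s_i\ge 0$ is measurable with $\phi_i\{s_i>0\}>0$ and $\nu_i$ is a probability measure. Let $\{X_t\}$ be Harris recurrent and $\{W_t\}$ ergodic, i.e. $P_2$ has an invariant probability measure to which $P_2^n(w,\cdot)$ converges in total variation for every $w$. Put $\pi_{s_i}=\nu_i\sum_{\ell\ge 0}(P_i-s_i\otimes\nu_i)^\ell$ and $\nu=\nu_1\otimes\nu_2$. Let $(X_t,Y^1_t)$ and $(W_t,Y^2_t)$ be the independent split chains: $Y^1_t\in\{0,1\}$ equals $1$ with probability $s_1(X_t)$ given $X_t$; given $X_t=x$ and $Y^1_t$, the next state $X_{t+1}$ has law $\nu_1$ if $Y^1_t=1$ and law $(1-s_1(x))^{-1}(P_1(x,\cdot)-s_1(x)\nu_1)$ if $Y^1_t=0$; and likewise for $(W_t,Y^2_t)$. Let $\tau_{-1}=\tau^1_{-1}=-1$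 and, for $k\ge 0$, $$\tau_k=\inf\{t>\tau_{k-1}:Y^1_t=Y^2_t=1\},\qquad \tau^1_k=\inf\{t>\tau^1_{k-1}:Y^1_t=1\},\qquad \mathcal T=\inf\{j\ge 0: Y^2_{\tau^1_j}=1\}.$$ For a function $g$ on $E_1\times E_2$ let $U_j(g)=\sum_{t=\tau_{j-1}+1}^{\tau_j}g(X_t,W_t)$, and let $U(g)$ denote a random variable with the common law of the blocks $U_j(g)$, $j\ge 1$ (this law does not depend on the initial distribution of $(X_0,W_0)$). $\mathbb E_\nu$ is expectation when $(X_0,W_0)\sim\nu$. Let $K:\mathbb R\to[0,\infty)$ be measurable, $x\in E_1$, $K_{x,h}(y)=h^{-1}K((y-x)/h)$, $\mathcal N_x(h)=\{y\in\mathbb R:K_{x,h}(y)\ne 0\}$ and $\mathcal N_x=\mathcal N_x(1)$. Assume: * ($B_2$) $K$ is bounded, $\mathcal N_x$ is bounded, and $\mathcal N_x\cap E_1$ is a small set for $\{X_t\}$, i.e. it is $\phi_1$-positive and $P_1^{n}(y,\cdot)\ge b\lambda$ for all $y\in\mathcal N_x\cap E_1$, for some integer $n\ge 1$, some $b>0$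 and some nonzero measure $\lambda$; * ($B_3$) $\pi_{s_1}$ has a density with respect to Lebesgue measure on $E_1$ that is continuous and strictly positive at $x$. Let $g_W:E_2\to\mathbb R$ be measurable and $g_h(z,w)=K_{x,h}(z)\,g_W(w)$. **Theorem 3.3.** There are finite constants $d'_1,d'_2,\dots$ which, for the given chain $\{X_t\}$ with its atom $(s_1,\nu_1)$ and the given point $x$, depend only on $\mathcal N_x$ and on an upper bound for $\sup_uK(u)$ (and not on $h$, on $g_W$, on the chain $\{W_t\}$, or on $K$ otherwise) such that for all integers $k,m\ge 1$ and all $h\in(0,1]$ with $\mathcal N_x(h)\cap E_1\subseteq\mathcal N_x$, $$\mathbb E|U(g_h)|^{2m}\le d_{m,k}\,h^{-2m+1/(k+1)},$$ $$d_{m,k}=\Big(\pi_{s_2}|g_W|^{2m(k+1)}\Big)^{1/(k+1)}\Big(\mathbb E_\nu(\mathcal T+1)^{2m(k+1)/k}\Big)^{k/(k+1)}\big(d'_{2m(k+1)}\big)^{1/(k+1)},$$ where the moments of $g_W$ and $\mathcal T$ may be infinite (with $0\cdot\infty=0$). The condition on $h$ holds for all $h\in(0,1]$ if $\{u:K(u)\neq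 0\}$ is star-shaped about $0$, and for all sufficiently small $h$ if $\mathcal N_x$ is a neighbourhood of $x$. -/

import Mathlib

open MeasureTheory ProbabilityTheory Filter Topology
open scoped ENNReal NNReal

noncomputable section

namespace NullRec

/-- The law, on the space of trajectories, of the time-homogeneous Markov chain with
initial distribution `init` and transition probability `κ`. -/
def chainLaw {S : Type*} [MeasurableSpace S] (κ : Kernel S S) [IsMarkovKernel κ]
    (init : Measure S) : Measure (ℕ → S) :=
  Kernel.trajMeasure (X := fun _ => S) init
    (fun n => κ.comap (fun p : (i : Finset.Iic n) → S => p ⟨n, by simp⟩)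
      (measurable_pi_apply _))

/-- `η` belongs to `ℰ⁺`: it is a measurable nonnegative function with `φ`-positive support. -/
def IsPlus {E : Type*} [MeasurableSpace E] (φ : Measure E) (η : E → ℝ≥0∞) : Prop :=
  Measurable η ∧ 0 < φ {x | 0 < η x}

/-- `η ∈ ℰ⁺` is small: `P ^ m ≥ b • (η ⊗ l)` for some nontrivial measure `l`, some constant
`b > 0` and some integer `m ≥ 1`. -/
def IsSmall {E : Type*} [MeasurableSpace E] (φ : Measure E) (P : Kernel E E)
    (η : E → ℝ≥0∞) : Prop :=
  IsPlus φ η ∧ ∃ (l : Measure E) (b : ℝ≥0∞) (m : ℕ), l ≠ 0 ∧ 0 < b ∧ 1 ≤ m ∧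
    ∀ x, (b * η x) • l ≤ (P ^ m) x

/-- A set is small if its indicator function is small. -/
def IsSmallSet {E : Type*} [MeasurableSpace E] (φ : Measure E) (P : Kernel E E)
    (A : Set E) : Prop :=
  MeasurableSet A ∧ IsSmall φ P (A.indicator 1)

/-- Harris recurrence with respect to `φ`: from every starting point, every `φ`-positive
measurable set is visited infinitely often with probability one. -/
def IsHarris {E : Type*} [MeasurableSpace E] (φ : Measure E) (P : Kernel E E)
    [IsMarkovKernel P] : Prop :=
  ∀ A, MeasurableSet A → 0 < φ A → ∀ x, ∀ᵐ p ∂(chainLaw P (Measure.dirac x)),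
    ∃ᶠ t in atTop, p t ∈ A

/-- Ergodicity: there is an invariant probability measure to which the `n`-step transition
probabilities converge in total variation, from every starting point. -/
def IsErgodic {E : Type*} [MeasurableSpace E] (P : Kernel E E) : Prop :=
  ∃ q : Measure E, IsProbabilityMeasure q ∧ Kernel.Invariant P q ∧
    ∀ x, ∀ ε : ℝ, 0 < ε → ∀ᶠ n : ℕ in atTop, ∀ A, MeasurableSet A →
      |((P ^ n) x).real A - q.real A| ≤ ε

/-- A transition probability `P` with an atom `(s, ν)`, that is, with the minorization
inequality `P ≥ s ⊗ ν`, where `ν` is a probability measure. -/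
structure AtomicChain (E : Type*) [MeasurableSpace E] where
  P : Kernel E E
  markov : IsMarkovKernel P
  s : E → ℝ≥0∞
  measurable_s : Measurable s
  ν : Measure E
  prob : IsProbabilityMeasure ν
  minorization : ∀ x, s x • ν ≤ P x

namespace AtomicChain

variable {E : Type*} [MeasurableSpace E] (c : AtomicChain E)

instance : IsMarkovKernel c.P := c.markov

instance : IsProbabilityMeasure c.ν := c.prob

/-- The chain is `φ`-irreducible for the nontrivial measure `φ`, and `s ∈ ℰ⁺`. Given the
minorization inequality, this makes `s` and `ν` small. -/
def IsIrred (φ : Measure E) : Prop :=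
  φ ≠ 0 ∧ Kernel.IsIrreducible φ c.P ∧ IsPlus φ c.s

theorem s_le_one (x : E) : c.s x ≤ 1 := by
  have h := c.minorization x Set.univ
  simpa using h

theorem isFiniteMeasure_smul (x : E) : IsFiniteMeasure (c.s x • c.ν) :=
  ⟨by simpa using (c.s_le_one x).trans_lt ENNReal.one_lt_top⟩

theorem sub_apply_eq (x : E) {A : Set E} (hA : MeasurableSet A) :
    (c.P x - c.s x • c.ν) A = c.P x A - c.s x * c.ν A := by
  have := c.isFiniteMeasure_smul x
  rw [Measure.sub_apply hA (c.minorization x)]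
  simp

/-- The kernel `H = P - s ⊗ ν`. -/
def H : Kernel E E where
  toFun x := c.P x - c.s x • c.ν
  measurable' := by
    refine Measure.measurable_of_measurable_coe _ fun A hA => ?_
    simp only [c.sub_apply_eq _ hA]
    exact (c.P.measurable_coe hA).sub (c.measurable_s.mul_const _)

theorem H_apply (x : E) : c.H x = c.P x - c.s x • c.ν := rfl

/-- The kernel `G_{s,ν} = ∑ ℓ ≥ 0, (P - s ⊗ ν) ^ ℓ`. -/
def G : Kernel E E := Kernel.sum fun l : ℕ => c.H ^ l

/-- The invariant measure `π_s = ν G_{s,ν}`. -/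
def piS : Measure E := c.ν.bind c.G

/-- The transition probability `Q` in the decomposition `P = (1 - s) Q + s ⊗ ν`. -/
def Q : Kernel E E where
  toFun x := open scoped Classical in
    if c.s x < 1 then (1 - c.s x)⁻¹ • (c.P x - c.s x • c.ν) else Measure.dirac x
  measurable' := by
    refine Measurable.ite (measurableSet_lt c.measurable_s measurable_const) ?_
      Measure.measurable_dirac
    refine Measure.measurable_of_measurable_coe _ fun A hA => ?_
    simp only [Measure.smul_apply, c.sub_apply_eq _ hA, smul_eq_mul]
    exact (measurable_const.sub c.measurable_s).inv.mul
      ((c.P.measurable_coe hA).sub (c.measurable_s.mul_const _))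

open scoped Classical in
theorem Q_apply (x : E) : c.Q x =
    if c.s x < 1 then (1 - c.s x)⁻¹ • (c.P x - c.s x • c.ν) else Measure.dirac x := rfl

instance : IsMarkovKernel c.Q := ⟨fun x => ⟨by
  rw [Q_apply]
  split_ifs with h
  · rw [Measure.smul_apply, c.sub_apply_eq x MeasurableSet.univ, smul_eq_mul]
    simp only [measure_univ, mul_one]
    exact ENNReal.inv_mul_cancel (tsub_pos_of_lt h).ne'
      (ne_top_of_le_ne_top ENNReal.one_ne_top tsub_le_self)
  · simp⟩⟩

/-- The distribution of `Y_t` given `X_t = x`: the value `1` (here `true`) has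
probability `s x`. -/
def coin : Kernel E Bool where
  toFun x := c.s x • Measure.dirac true + (1 - c.s x) • Measure.dirac false
  measurable' := by
    refine Measure.measurable_of_measurable_coe _ fun A hA => ?_
    simp only [Measure.add_apply, Measure.smul_apply, smul_eq_mul]
    exact (c.measurable_s.mul_const _).add
      ((measurable_const.sub c.measurable_s).mul_const _)

instance : IsMarkovKernel c.coin := ⟨fun x => ⟨by
  change (c.s x • Measure.dirac true + (1 - c.s x) • Measure.dirac false : Measure Bool) _ = 1
  simp [add_tsub_cancel_of_le (c.s_le_one x)]⟩⟩

/-- The distribution of `X_{t+1}` given `(X_t, Y_t) = (x, y)`: it is `ν` if `y = 1`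
(regeneration) and `Q x` if `y = 0`. -/
def move : Kernel (E × Bool) E where
  toFun z := if z.2 = true then c.ν else c.Q z.1
  measurable' := by
    refine Measurable.ite ?_ measurable_const (c.Q.measurable.comp measurable_fst)
    exact measurable_snd (measurableSet_singleton true)

instance : IsMarkovKernel c.move := ⟨fun z => by
  change IsProbabilityMeasure (if z.2 = true then c.ν else c.Q z.1)
  split_ifs <;> infer_instance⟩

/-- The transition probability of the split chain `(X_t, Y_t)`. -/
def splitKernel : Kernel (E × Bool) (E × Bool) :=
  (Kernel.id ×ₖ c.coin) ∘ₖ c.move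

instance : IsMarkovKernel c.splitKernel := by unfold splitKernel; infer_instance

/-- The law of the split chain when `X_0` has distribution `init`. -/
def splitLaw (init : Measure E) : Measure (ℕ → E × Bool) :=
  chainLaw c.splitKernel (init ⊗ₘ c.coin)

end AtomicChain

/-- The successive regeneration times `τ_k`, `k ≥ 0`, of a trajectory `y` of the auxiliary
chain, the infimum of the empty set being `∞`. -/
def regen (y : ℕ → Bool) : ℕ → ℕ∞
  | 0 => ⨅ (t : ℕ) (_ : y t = true), (t : ℕ∞)
  | k + 1 => ⨅ (t : ℕ) (_ : y t = true ∧ regen y k < t), (t : ℕ∞)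

/-- The `k`-th block `{τ_{k-1} + 1, …, τ_k}` of time points, where `τ_{-1} = -1`. -/
def block (y : ℕ → Bool) : ℕ → Set ℕ
  | 0 => {t | (t : ℕ∞) ≤ regen y 0}
  | k + 1 => {t | regen y k < t ∧ (t : ℕ∞) ≤ regen y (k + 1)}

section Compound

variable {E₁ E₂ : Type*} [MeasurableSpace E₁] [MeasurableSpace E₂]

/-- The trajectories of the pair of split chains `(X_t, Y¹_t)` and `(W_t, Y²_t)`. -/
abbrev Path (E₁ E₂ : Type*) := (ℕ → E₁ × Bool) × (ℕ → E₂ × Bool)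

/-- The law of the pair of independent split chains when `(X_0, W_0)` has distribution
`l₁ ⊗ l₂`. -/
def pairLaw (c₁ : AtomicChain E₁) (c₂ : AtomicChain E₂) (l₁ : Measure E₁) (l₂ : Measure E₂) :
    Measure (Path E₁ E₂) :=
  (c₁.splitLaw l₁).prod (c₂.splitLaw l₂)

/-- The auxiliary chain `Y_t = Y¹_t Y²_t` of the compound chain `(X_t, W_t)`. -/
def compoundY (ω : Path E₁ E₂) : ℕ → Bool := fun t => (ω.1 t).2 && (ω.2 t).2

/-- The block sum `U_k(g) = ∑ g(X_t, W_t)` over the times `t` in the `k`-th regeneration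
block of the compound chain. -/
def blockSum (g : E₁ × E₂ → ℝ) (k : ℕ) (ω : Path E₁ E₂) : ℝ :=
  ∑' t, (block (compoundY ω) k).indicator (fun t => g ((ω.1 t).1, (ω.2 t).1)) t

/-- The regeneration time `𝒯 = inf {j ≥ 0 : Y²_{τ¹_j} = 1}` of the chain `(W_t, Y²_t)` embedded
at the regeneration times `τ¹_j` of `(X_t, Y¹_t)`. -/
def embeddedRegen (ω : Path E₁ E₂) : ℕ∞ :=
  ⨅ (j : ℕ) (_ : ∃ t : ℕ, regen (fun i => (ω.1 i).2) j = t ∧ (ω.2 t).2 = true), (j : ℕ∞)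

/-- The constant
`d_{m,k} = (π_{s₂} |g_W|^{2m(k+1)})^{1/(k+1)} (E_ν |𝒯 + 1|^{2m(k+1)/k})^{k/(k+1)} d^{1/(k+1)}`. -/
def momentConst (c₁ : AtomicChain E₁) (c₂ : AtomicChain E₂) (gW : E₂ → ℝ) (d : ℝ≥0)
    (m k : ℕ) : ℝ≥0∞ :=
  (∫⁻ w, ‖gW w‖ₑ ^ (2 * m * (k + 1)) ∂c₂.piS) ^ (1 / (k + 1) : ℝ) *
    (∫⁻ ω, ((embeddedRegen ω + 1 : ℕ∞) : ℝ≥0∞) ^ (2 * m * (k + 1) / k : ℝ)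
      ∂(pairLaw c₁ c₂ c₁.ν c₂.ν)) ^ (k / (k + 1) : ℝ) *
    (d : ℝ≥0∞) ^ (1 / (k + 1) : ℝ)

end Compound

/-- The rescaled kernel `K_{x,h}(y) = h⁻¹ K((y - x) / h)`. -/
def scaled (K : ℝ → ℝ) (x h y : ℝ) : ℝ := h⁻¹ * K ((y - x) / h)

/-- The set `𝒩_x(h) = {y : K_{x,h}(y) ≠ 0}`. -/
def nbhd (K : ℝ → ℝ) (x h : ℝ) : Set ℝ := {y | scaled K x h y ≠ 0}

end NullRec

end

noncomputable section

namespace NullRec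

/-! Cut the compound trajectory at the regenerations of X alone. The first compound block is covered
by the blocks of X numbered 0, …, 𝒯; let V_j be the sum of |g_h| over the j-th of these. With q =
2m(k+1), the block sum is at most (𝒯+1) max V_j ≤ (𝒯+1) (∑_{j≤𝒯} V_j^q)^{1/q}
(`blockTsum_compound_le_mul`), and Hölder's inequality with exponents (k+1)/k and k+1 separates the
moment of 𝒯 from E ∑_{j≤𝒯} V_j^q.

To bound this expectation, observe W just after each regeneration of X. By independence this is a
Markov chain; killed at 𝒯, its transition operator is R = ∑_n p_n P₂^n H₂, where p_n is the
probability that X first regenerates at time n. Since ν₂ + π_{s₂}H₂ = π_{s₂} and π_{s₂}P₂ ≤ π_{s₂},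
one has ν₂f + π_{s₂}Rf ≤ π_{s₂}f, and iteration gives ∑_j ν₂R^j f ≤ π_{s₂}f
(`tsum_lintegral_embeddedOp_iterate_le`). Hence E ∑_{j≤𝒯} V_j^q is at most the mean of V_0^q with
W_0 distributed as π_{s₂}. Jensen's inequality inside this one block, independence and subinvariance
bound that by π_{s₂}|g_W|^q · E S^q, where S sums K_{x,h}(X_t) over a block of X
(`lintegral_piS_pairMean_le`).

The moments of S obey E_y S^{q+1} ≤ (q+1) G(K_{x,h} · E_· S^q)(y) (`blockMoment_succ_le`). The
potential of the small set 𝒩_x is bounded by a constant C (`exists_G_le_of_isSmallSet`), so each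
application costs a factor C M/h, except the outermost: integrated against ν₁, it gives (M/h)
π_{s₁}(𝒩_x(h)), and π_{s₁}(𝒩_x(h)) = O(h) by continuity of the density at x (`exists_piS_le_mul`).
Thus E S^q = O(h^{1-q}), whose power 1/(k+1) is the asserted rate. Later blocks and arbitrary
initial laws reduce to the first block after a regeneration by the Markov property
(`lintegral_blockTsum_pow_le`). -/

/-- The trajectory that starts at `z` and then follows `ω`. -/
def pathCons {S : Type*} (z : S) (ω : ℕ → S) : ℕ → S
  | 0 => z
  | n + 1 => ω n

@[simp] theorem pathCons_zero {S : Type*} (z : S) (ω : ℕ → S) : pathCons z ω 0 = z := rfl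

@[simp] theorem pathCons_succ {S : Type*} (z : S) (ω : ℕ → S) (n : ℕ) :
    pathCons z ω (n + 1) = ω n := rfl

/-! ### Trajectory laws as kernels and the Markov property at time one -/

section ChainKernel

variable {S : Type*} [MeasurableSpace S]

@[fun_prop]
theorem measurable_pathCons : Measurable fun p : S × (ℕ → S) => pathCons p.1 p.2 := by
  refine measurable_pi_lambda _ fun n => ?_
  cases n with
  | zero => exact measurable_fst
  | succ n => exact (measurable_pi_apply n).comp measurable_snd

theorem measurable_pathCons_right (z : S) : Measurable (pathCons z) :=
  measurable_pathCons.comp measurable_prodMk_left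

variable (κ : Kernel S S) [IsMarkovKernel κ]

/-- The kernels of the inhomogeneous description of a homogeneous chain. -/
abbrev historyKernel (n : ℕ) : Kernel ((i : Finset.Iic n) → S) S :=
  κ.comap (fun p : (i : Finset.Iic n) → S => p ⟨n, by simp⟩) (measurable_pi_apply _)

/-- The law of the trajectory of the chain as a function of the starting point. -/
def chainKernel : Kernel S (ℕ → S) :=
  (Kernel.traj (X := fun _ => S) (historyKernel κ) 0).comap (fun z _ => z)
    (measurable_pi_lambda _ fun _ => measurable_id)

instance : IsMarkovKernel (chainKernel κ) := by unfold chainKernel; infer_instance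

theorem lintegral_chainLaw (μ : Measure S) {F : (ℕ → S) → ℝ≥0∞} (hF : Measurable F) :
    ∫⁻ ω, F ω ∂chainLaw κ μ = ∫⁻ z, ∫⁻ ω, F ω ∂chainKernel κ z ∂μ := by
  have hm : Measurable fun p => ∫⁻ ω, F ω ∂Kernel.traj (X := fun _ => S) (historyKernel κ) 0 p :=
    hF.lintegral_kernel
  rw [chainLaw, Kernel.trajMeasure, Measure.lintegral_bind (Kernel.measurable _).aemeasurable
    hF.aemeasurable]
  refine (lintegral_map hm (MeasurableEquiv.measurable _)).trans (lintegral_congr fun z => ?_)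
  rw [chainKernel, Kernel.comap_apply]
  rfl

/-- The trajectory up to time `b`. -/
abbrev upTo (b : ℕ) (ω : ℕ → S) : (i : Finset.Iic b) → S := fun i => ω i

theorem measurable_upTo (b : ℕ) : Measurable (upTo (S := S) b) :=
  measurable_pi_lambda _ fun _ => measurable_pi_apply _

theorem lintegral_partialTraj_succ (b : ℕ) (x : (i : Finset.Iic 0) → S)
    {g : ((i : Finset.Iic (b + 1)) → S) → ℝ≥0∞} (hg : Measurable g) :
    ∫⁻ u, g u ∂Kernel.partialTraj (X := fun _ => S) (historyKernel κ) 0 (b + 1) x =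
      ∫⁻ u, ∫⁻ y, g (IicProdIoc (X := fun _ => S) b (b + 1)
          (u, MeasurableEquiv.piSingleton (X := fun _ => S) b y))
        ∂κ (u ⟨b, by simp⟩) ∂Kernel.partialTraj (X := fun _ => S) (historyKernel κ) 0 b x := by
  have hm : Measurable (IicProdIoc (X := fun _ => S) b (b + 1)) := measurable_IicProdIoc
  have hgm : Measurable fun p => g (IicProdIoc (X := fun _ => S) b (b + 1) p) := hg.comp hm
  rw [Kernel.partialTraj_succ_of_le (Nat.zero_le b), Kernel.map_apply _ hm,
    lintegral_map hg hm, Kernel.lintegral_comp _ _ _ hgm]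
  refine lintegral_congr fun u => ?_
  have hgu : Measurable fun v => g (IicProdIoc (X := fun _ => S) b (b + 1) (u, v)) :=
    hgm.comp measurable_prodMk_left
  rw [Kernel.lintegral_id_prod hgm, Kernel.map_apply _ (by fun_prop),
    lintegral_map hgu (by fun_prop), Kernel.comap_apply]

/-- A trajectory law is determined by its marginals on initial segments, and these are built up one
time at a time from the conditional law of the next state. -/
theorem traj_eq_of_step (η : Kernel ((i : Finset.Iic 0) → S) (ℕ → S))
    (hzero : ∀ x, (η x).map (upTo 0) = Measure.dirac x)
    (hstep : ∀ (b : ℕ) x (f : ((i : Finset.Iic b) → S) × S → ℝ≥0∞), Measurable f →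
      ∫⁻ ω, f (upTo b ω, ω (b + 1)) ∂η x = ∫⁻ ω, ∫⁻ y, f (upTo b ω, y) ∂κ (ω b) ∂η x) :
    η = Kernel.traj (X := fun _ => S) (historyKernel κ) 0 := by
  refine Kernel.eq_traj (X := fun _ => S) (historyKernel κ) η fun b => ?_
  induction b with
  | zero =>
    ext1 x
    rw [Kernel.map_apply _ (by fun_prop), Kernel.partialTraj_self, Kernel.id_apply]
    exact hzero x
  | succ b ih =>
    ext1 x
    refine Measure.ext_of_lintegral _ fun g hg => ?_
    have hm : Measurable fun p : ((i : Finset.Iic b) → S) × S =>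
        g (IicProdIoc (X := fun _ => S) b (b + 1)
          (p.1, MeasurableEquiv.piSingleton (X := fun _ => S) b p.2)) := by
      refine hg.comp (measurable_IicProdIoc.comp (measurable_fst.prodMk ?_))
      exact (MeasurableEquiv.measurable _).comp measurable_snd
    rw [lintegral_partialTraj_succ κ b x hg, ← ih, Kernel.map_apply _ (by fun_prop),
      Kernel.map_apply _ (by fun_prop), lintegral_map hg (by fun_prop), lintegral_map]
    · refine Eq.trans (lintegral_congr fun ω => ?_) (hstep b x _ hm)
      congr 1
      ext ⟨i, hi⟩
      rw [IicProdIoc]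
      split_ifs with h
      · rfl
      · obtain rfl : i = b + 1 := by
          have := Finset.mem_Iic.1 hi
          simp only at h
          omega
        rfl
    · exact Measurable.lintegral_kernel_prod_right'
        (κ := κ.comap (fun p : (i : Finset.Iic b) → S => p ⟨b, by simp⟩) (measurable_pi_apply _)) hm
    · fun_prop

theorem lintegral_chainKernel_next (z : S) (b : ℕ) {f : ((i : Finset.Iic b) → S) × S → ℝ≥0∞}
    (hf : Measurable f) :
    ∫⁻ ω, f (upTo b ω, ω (b + 1)) ∂chainKernel κ z =
      ∫⁻ ω, ∫⁻ y, f (upTo b ω, y) ∂κ (ω b) ∂chainKernel κ z := by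
  have h := Kernel.partialTraj_compProd_eq_map_traj (X := fun _ => S) (κ := historyKernel κ)
    (Nat.zero_le b) (x₀ := fun _ => z)
  have h' := congrArg (fun μ => ∫⁻ p, f p ∂μ) h
  beta_reduce at h'
  rw [lintegral_map hf (by fun_prop), Measure.lintegral_compProd hf,
    ← Kernel.traj_map_frestrictLe, Kernel.map_apply _ (by fun_prop),
    lintegral_map (Measurable.lintegral_kernel_prod_right' hf) (by fun_prop)] at h'
  exact h'.symm

/-- The kernel that makes one step according to `κ` and then follows the chain. -/
def stepKernel : Kernel ((i : Finset.Iic 0) → S) (ℕ → S) :=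
  ((Kernel.id ×ₖ (chainKernel κ ∘ₖ κ)).map fun p => pathCons p.1 p.2).comap
    (fun x => x ⟨0, by simp⟩) (measurable_pi_apply _)

theorem lintegral_stepKernel (x : (i : Finset.Iic 0) → S) {F : (ℕ → S) → ℝ≥0∞}
    (hF : Measurable F) :
    ∫⁻ ω, F ω ∂stepKernel κ x = ∫⁻ y, ∫⁻ ω, F (pathCons (x ⟨0, by simp⟩) ω)
      ∂chainKernel κ y ∂κ (x ⟨0, by simp⟩) := by
  have hFm : Measurable fun p : S × (ℕ → S) => F (pathCons p.1 p.2) :=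
    hF.comp measurable_pathCons
  rw [stepKernel, Kernel.comap_apply, Kernel.map_apply _ measurable_pathCons,
    lintegral_map hF measurable_pathCons,
    Kernel.lintegral_id_prod hFm]
  exact Kernel.lintegral_comp _ _ _ (hF.comp (measurable_pathCons_right _))

theorem chainKernel_zero (z : S) : (chainKernel κ z).map (fun ω => ω 0) = Measure.dirac z := by
  have h := Kernel.traj_map_frestrictLe_apply (X := fun _ => S) (κ := historyKernel κ) 0 0
    (fun _ => z)
  rw [Kernel.partialTraj_self, Kernel.id_apply] at h
  have h' := congrArg (Measure.map fun u : (i : Finset.Iic 0) → S => u ⟨0, by simp⟩) h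
  rw [Measure.map_map (measurable_pi_apply _) (by fun_prop)] at h'
  exact h'.trans (Measure.map_dirac' (measurable_pi_apply _) _)

/-- Both kernels have the same start and the same conditional law of the next state given the past,
so uniqueness identifies them. This is the Markov property at time one, the source of all first-step
arguments below. -/
theorem stepKernel_eq_traj :
    stepKernel κ = Kernel.traj (X := fun _ => S) (historyKernel κ) 0 := by
  refine traj_eq_of_step κ _ (fun x => ?_) fun b x f hf => ?_
  · refine Measure.ext_of_lintegral _ fun g hg => ?_
    have hgm : Measurable fun ω : ℕ → S => g (upTo 0 ω) := hg.comp (measurable_upTo 0)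
    rw [lintegral_map hg (measurable_upTo 0), lintegral_stepKernel κ x hgm, lintegral_dirac' _ hg]
    have : ∀ ω : ℕ → S, upTo 0 (pathCons (x ⟨0, by simp⟩) ω) = x := by
      intro ω
      ext ⟨i, hi⟩
      obtain rfl : i = 0 := by simpa using hi
      rfl
    simp [this]
  · have h1 : Measurable fun ω : ℕ → S => f (upTo b ω, ω (b + 1)) :=
      hf.comp ((measurable_upTo b).prodMk (measurable_pi_apply _))
    have h2 : Measurable fun ω : ℕ → S => ∫⁻ y, f (upTo b ω, y) ∂κ (ω b) := by
      refine Measurable.lintegral_kernel_prod_right' (κ := κ.comap (fun ω : ℕ → S => ω b)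
        (measurable_pi_apply b)) (f := fun p : (ℕ → S) × S => f (upTo b p.1, p.2)) ?_
      exact hf.comp (((measurable_upTo b).comp measurable_fst).prodMk measurable_snd)
    rw [lintegral_stepKernel κ x h1, lintegral_stepKernel κ x h2]
    generalize x ⟨0, by simp⟩ = z
    cases b with
    | zero =>
      simp only [pathCons_succ, pathCons_zero, zero_add]
      have hc : ∀ ω : ℕ → S, upTo 0 (pathCons z ω) = fun _ => z := by
        intro ω
        ext ⟨i, hi⟩
        obtain rfl : i = 0 := by simpa using hi
        rfl
      have hg : Measurable fun y => f ((fun _ => z), y) := hf.comp measurable_prodMk_left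
      simp only [hc, lintegral_const, measure_univ, mul_one]
      refine lintegral_congr fun y => ?_
      have := congrArg (fun μ => ∫⁻ y, f ((fun _ => z), y) ∂μ) (chainKernel_zero κ y)
      beta_reduce at this
      rwa [lintegral_map hg (measurable_pi_apply 0), lintegral_dirac' _ hg] at this
    | succ b =>
      refine lintegral_congr fun y => ?_
      -- The history of the concatenated trajectory is recovered from that of its tail: `z` at time
      -- 0 and the tail at time `i - 1` afterwards.
      let g : ((i : Finset.Iic b) → S) → (i : Finset.Iic (b + 1)) → S := fun u i =>
        if h : i.1 = 0 then z else u ⟨i.1 - 1, by have := Finset.mem_Iic.1 i.2; simp; omega⟩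
      have hg : Measurable g := by
        refine measurable_pi_lambda _ fun i => ?_
        by_cases h : i.1 = 0
        · simp [g, h]
        · simp only [g, h, dite_false]; exact measurable_pi_apply _
      have hgu : ∀ ω : ℕ → S, upTo (b + 1) (pathCons z ω) = g (upTo b ω) := by
        intro ω
        ext ⟨i, hi⟩
        cases i with
        | zero => rfl
        | succ i => rfl
      simp only [hgu, pathCons_succ]
      exact lintegral_chainKernel_next κ y b
        (f := fun p => f (g p.1, p.2)) (hf.comp ((hg.comp measurable_fst).prodMk measurable_snd))

theorem lintegral_chainKernel_step (z : S) {F : (ℕ → S) → ℝ≥0∞} (hF : Measurable F) :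
    ∫⁻ ω, F ω ∂chainKernel κ z = ∫⁻ y, ∫⁻ ω, F (pathCons z ω) ∂chainKernel κ y ∂κ z := by
  rw [chainKernel, Kernel.comap_apply, ← stepKernel_eq_traj, lintegral_stepKernel κ _ hF,
    chainKernel, stepKernel_eq_traj]

end ChainKernel

/-! ### First-step analysis of the split chain -/

namespace AtomicChain

variable {E : Type*} [MeasurableSpace E] (c : AtomicChain E)

theorem lintegral_coin (x : E) (f : Bool → ℝ≥0∞) :
    ∫⁻ y, f y ∂c.coin x = c.s x * f true + (1 - c.s x) * f false := by
  change ∫⁻ y, f y ∂(c.s x • Measure.dirac true + (1 - c.s x) • Measure.dirac false) = _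
  simp

theorem H_add (x : E) : c.H x + c.s x • c.ν = c.P x := by
  have := c.isFiniteMeasure_smul x
  exact Measure.sub_add_cancel_of_le (c.minorization x)

theorem lintegral_P (x : E) (f : E → ℝ≥0∞) :
    ∫⁻ y, f y ∂c.P x = ∫⁻ y, f y ∂c.H x + c.s x * ∫⁻ y, f y ∂c.ν := by
  rw [← c.H_add x, lintegral_add_measure, lintegral_smul_measure, smul_eq_mul]

theorem H_univ (x : E) : c.H x Set.univ = 1 - c.s x := by
  rw [H_apply, c.sub_apply_eq x MeasurableSet.univ]; simp

instance : IsFiniteKernel c.H := ⟨1, ENNReal.one_lt_top, fun x => by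
  rw [H_univ]; exact tsub_le_self⟩

/-- The default value of `Q` where `s = 1` is harmless: there the factor `1 - s` and the total mass
of `H` both vanish. -/
theorem H_eq_smul_Q (x : E) : c.H x = (1 - c.s x) • c.Q x := by
  rw [Q_apply]
  split_ifs with h
  · rw [smul_smul, ENNReal.mul_inv_cancel (tsub_pos_of_lt h).ne'
      (ne_top_of_le_ne_top ENNReal.one_ne_top tsub_le_self), one_smul, H_apply]
  · have h1 : 1 - c.s x = 0 := tsub_eq_zero_of_le (not_lt.1 h)
    rw [h1, zero_smul, ← Measure.measure_univ_eq_zero, H_univ, h1]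

/-- The law of the trajectory of the split chain as a function of the starting point of the
original chain. -/
def path : Kernel E (ℕ → E × Bool) :=
  chainKernel c.splitKernel ∘ₖ (Kernel.id ×ₖ c.coin)

instance : IsMarkovKernel c.path := by unfold path; infer_instance

theorem lintegral_path (x : E) {F : (ℕ → E × Bool) → ℝ≥0∞} (hF : Measurable F) :
    ∫⁻ ω, F ω ∂c.path x = c.s x * ∫⁻ ω, F ω ∂chainKernel c.splitKernel (x, true) +
      (1 - c.s x) * ∫⁻ ω, F ω ∂chainKernel c.splitKernel (x, false) := by
  rw [path, Kernel.lintegral_comp _ _ _ hF, Kernel.lintegral_id_prod hF.lintegral_kernel,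
    lintegral_coin]

theorem lintegral_splitLaw (l : Measure E) [SFinite l] {F : (ℕ → E × Bool) → ℝ≥0∞}
    (hF : Measurable F) : ∫⁻ ω, F ω ∂c.splitLaw l = ∫⁻ x, ∫⁻ ω, F ω ∂c.path x ∂l := by
  rw [splitLaw, lintegral_chainLaw _ _ hF, Measure.lintegral_compProd hF.lintegral_kernel]
  refine lintegral_congr fun x => ?_
  rw [c.lintegral_path x hF, lintegral_coin]

instance (l : Measure E) [IsProbabilityMeasure l] : IsProbabilityMeasure (c.splitLaw l) := ⟨by
  rw [← lintegral_one, c.lintegral_splitLaw l measurable_const]; simp⟩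

theorem lintegral_splitChain_step (z : E × Bool) {F : (ℕ → E × Bool) → ℝ≥0∞}
    (hF : Measurable F) :
    ∫⁻ ω, F ω ∂chainKernel c.splitKernel z =
      ∫⁻ y, ∫⁻ ω, F (pathCons z ω) ∂c.path y ∂c.move z := by
  have hc : Measurable fun ω => F (pathCons z ω) := hF.comp (measurable_pathCons_right z)
  rw [lintegral_chainKernel_step _ _ hF]
  refine (Kernel.lintegral_comp (Kernel.id ×ₖ c.coin) c.move z hc.lintegral_kernel).trans ?_
  refine lintegral_congr fun y => ?_
  rw [Kernel.lintegral_id_prod hc.lintegral_kernel, lintegral_coin, c.lintegral_path y hc]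

/-- The one-step decomposition of the split chain: it regenerates with probability `s x`. -/
theorem lintegral_path_step (x : E) {F : (ℕ → E × Bool) → ℝ≥0∞} (hF : Measurable F) :
    ∫⁻ ω, F ω ∂c.path x = c.s x * ∫⁻ y, ∫⁻ ω, F (pathCons (x, true) ω) ∂c.path y ∂c.ν +
      ∫⁻ y, ∫⁻ ω, F (pathCons (x, false) ω) ∂c.path y ∂c.H x := by
  rw [c.lintegral_path x hF, c.lintegral_splitChain_step _ hF, c.lintegral_splitChain_step _ hF,
    H_eq_smul_Q, lintegral_smul_measure, smul_eq_mul]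
  rfl

theorem lintegral_path_succ (x : E) {F : (ℕ → E × Bool) → ℝ≥0∞} (hF : Measurable F) :
    ∫⁻ ω, F (fun n => ω (n + 1)) ∂c.path x = ∫⁻ y, ∫⁻ ω, F ω ∂c.path y ∂c.P x := by
  have hs : Measurable fun ω : ℕ → E × Bool => F (fun n => ω (n + 1)) :=
    hF.comp (measurable_pi_lambda _ fun n => measurable_pi_apply _)
  rw [c.lintegral_path_step x hs, lintegral_P, add_comm]
  rfl

theorem lintegral_path_zero (x : E) {f : E → ℝ≥0∞} (hf : Measurable f) :
    ∫⁻ ω, f (ω 0).1 ∂c.path x = f x := by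
  have hF : Measurable fun ω : ℕ → E × Bool => f (ω 0).1 :=
    hf.comp (measurable_fst.comp (measurable_pi_apply 0))
  rw [c.lintegral_path_step x hF]
  simp only [pathCons_zero, lintegral_const, measure_univ, mul_one, H_univ]
  rw [mul_comm (f x), ← add_mul, add_tsub_cancel_of_le (c.s_le_one x), one_mul]

/-! ### Potential theory of the atom -/

theorem lintegral_pow_succ (κ : Kernel E E) (n : ℕ) (x : E) {f : E → ℝ≥0∞} (hf : Measurable f) :
    ∫⁻ y, f y ∂(κ ^ (n + 1)) x = ∫⁻ z, ∫⁻ y, f y ∂κ z ∂(κ ^ n) x := by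
  rw [pow_succ']
  exact Kernel.lintegral_comp _ _ _ hf

theorem lintegral_pow_succ' (κ : Kernel E E) (n : ℕ) (x : E) {f : E → ℝ≥0∞} (hf : Measurable f) :
    ∫⁻ y, f y ∂(κ ^ (n + 1)) x = ∫⁻ z, ∫⁻ y, f y ∂(κ ^ n) z ∂κ x := by
  rw [pow_succ]
  exact Kernel.lintegral_comp _ _ _ hf

theorem lintegral_path_apply (x : E) (n : ℕ) {f : E → ℝ≥0∞} (hf : Measurable f) :
    ∫⁻ ω, f (ω n).1 ∂c.path x = ∫⁻ y, f y ∂(c.P ^ n) x := by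
  induction n generalizing x with
  | zero =>
    rw [c.lintegral_path_zero x hf, pow_zero]
    exact (lintegral_dirac' _ hf).symm
  | succ n ih =>
    rw [lintegral_pow_succ' _ _ _ hf, c.lintegral_path_succ x
      (F := fun ω => f (ω n).1) (hf.comp (measurable_fst.comp (measurable_pi_apply n)))]
    exact lintegral_congr fun y => ih y

theorem lintegral_G (x : E) (f : E → ℝ≥0∞) :
    ∫⁻ y, f y ∂c.G x = ∑' l : ℕ, ∫⁻ y, f y ∂(c.H ^ l) x := by
  rw [G, Kernel.sum_apply, lintegral_sum_measure]

theorem lintegral_piS {f : E → ℝ≥0∞} (hf : Measurable f) :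
    ∫⁻ y, f y ∂c.piS = ∫⁻ x, ∫⁻ y, f y ∂c.G x ∂c.ν := by
  rw [piS, Measure.lintegral_bind c.G.measurable.aemeasurable hf.aemeasurable]

theorem lintegral_G_step (x : E) {f : E → ℝ≥0∞} (hf : Measurable f) :
    ∫⁻ y, f y ∂c.G x = f x + ∫⁻ z, ∫⁻ y, f y ∂c.G z ∂c.H x := by
  rw [c.lintegral_G x, tsum_eq_zero_add' ENNReal.summable]
  congr 1
  · rw [pow_zero]; exact lintegral_dirac' _ hf
  · simp_rw [c.lintegral_G]
    rw [lintegral_tsum fun l => hf.lintegral_kernel.aemeasurable]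
    exact tsum_congr fun l => lintegral_pow_succ' _ _ _ hf

theorem lintegral_G_step' (x : E) {f : E → ℝ≥0∞} (hf : Measurable f) :
    ∫⁻ y, f y ∂c.G x = f x + ∫⁻ z, ∫⁻ y, f y ∂c.H z ∂c.G x := by
  rw [c.lintegral_G x, tsum_eq_zero_add' ENNReal.summable, c.lintegral_G x]
  congr 1
  · rw [pow_zero]; exact lintegral_dirac' _ hf
  · exact tsum_congr fun l => lintegral_pow_succ _ _ _ hf

/-- This is ν + π_s H = π_s, obtained by splitting off the term ℓ = 0 of the potential series. -/
theorem lintegral_piS_step {f : E → ℝ≥0∞} (hf : Measurable f) :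
    ∫⁻ y, f y ∂c.ν + ∫⁻ z, ∫⁻ y, f y ∂c.H z ∂c.piS = ∫⁻ y, f y ∂c.piS := by
  rw [c.lintegral_piS hf, c.lintegral_piS hf.lintegral_kernel, ← lintegral_add_left hf]
  exact lintegral_congr fun x => (c.lintegral_G_step' x hf).symm

/-- H^ℓ s is the probability that the first regeneration occurs at time ℓ, so the series sums to the
probability of ever regenerating. The induction on partial sums conditions on the first step. -/
theorem lintegral_G_s_le (x : E) : ∫⁻ y, c.s y ∂c.G x ≤ 1 := by
  rw [c.lintegral_G x]
  refine ENNReal.tsum_le_of_sum_range_le fun n => ?_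
  induction n generalizing x with
  | zero => simp
  | succ n ih =>
    rw [Finset.sum_range_succ']
    simp_rw [lintegral_pow_succ' _ _ _ c.measurable_s]
    rw [← lintegral_finsetSum _ fun l _ => c.measurable_s.lintegral_kernel, pow_zero]
    calc _ ≤ ∫⁻ _, 1 ∂c.H x + c.s x := by
          refine add_le_add (lintegral_mono fun z => ih z) ?_
          exact (lintegral_dirac' _ c.measurable_s).le
      _ = 1 := by
          rw [lintegral_one, H_univ, tsub_add_cancel_of_le (c.s_le_one x)]

/-- π_s P = π_s H + π_s(s) ν, and π_s(s) ≤ 1, so subinvariance follows from ν + π_s H = π_s. -/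
theorem lintegral_piS_P_le {f : E → ℝ≥0∞} (hf : Measurable f) :
    ∫⁻ x, ∫⁻ y, f y ∂c.P x ∂c.piS ≤ ∫⁻ y, f y ∂c.piS := by
  simp_rw [lintegral_P]
  rw [lintegral_add_left hf.lintegral_kernel, lintegral_mul_const _ c.measurable_s, add_comm,
    ← c.lintegral_piS_step hf]
  gcongr
  refine mul_le_of_le_one_left' ?_
  rw [c.lintegral_piS c.measurable_s]
  exact (lintegral_mono fun x => c.lintegral_G_s_le x).trans (by simp)

theorem lintegral_piS_P_pow_le (n : ℕ) {f : E → ℝ≥0∞} (hf : Measurable f) :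
    ∫⁻ x, ∫⁻ y, f y ∂(c.P ^ n) x ∂c.piS ≤ ∫⁻ y, f y ∂c.piS := by
  induction n with
  | zero =>
    refine (lintegral_congr fun x => ?_).le
    rw [pow_zero]; exact lintegral_dirac' _ hf
  | succ n ih =>
    simp_rw [lintegral_pow_succ' _ _ _ hf]
    exact (c.lintegral_piS_P_le hf.lintegral_kernel).trans ih

/-- With f = P^n s ≤ 1 and P = H + s ⊗ ν, one has G P f = G H f + (G s) ν(f) ≤ G f + 1, so each
further power of P adds at most 1. -/
theorem lintegral_G_P_pow_s_le (x : E) (n : ℕ) :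
    ∫⁻ z, ∫⁻ y, c.s y ∂(c.P ^ n) z ∂c.G x ≤ n + 1 := by
  induction n with
  | zero =>
    refine (lintegral_congr fun z => ?_).trans_le ((c.lintegral_G_s_le x).trans (by simp))
    rw [pow_zero]; exact lintegral_dirac' _ c.measurable_s
  | succ n ih =>
    set f : E → ℝ≥0∞ := fun z => ∫⁻ y, c.s y ∂(c.P ^ n) z
    have hf : Measurable f := c.measurable_s.lintegral_kernel
    have hf1 : ∀ z, f z ≤ 1 := fun z => by
      simp only [f]
      rw [← c.lintegral_path_apply z n c.measurable_s]
      exact (lintegral_mono fun ω => c.s_le_one _).trans (by simp)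
    simp_rw [lintegral_pow_succ' _ _ _ c.measurable_s, lintegral_P]
    rw [lintegral_add_left hf.lintegral_kernel, lintegral_mul_const _ c.measurable_s]
    push_cast
    refine add_le_add ?_ ?_
    · refine le_trans ?_ ih
      rw [c.lintegral_G_step' x hf]
      exact le_add_self
    · refine mul_le_one' (c.lintegral_G_s_le x) ?_
      exact (lintegral_mono hf1).trans (by simp)

end AtomicChain

/-! ### First times and regeneration times -/

/-- The first time at which `p` holds, `⊤` if there is none. -/
def firstTime (p : ℕ → Prop) : ℕ∞ := ⨅ (t : ℕ) (_ : p t), (t : ℕ∞)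

theorem le_firstTime_iff {p : ℕ → Prop} {n : ℕ} : (n : ℕ∞) ≤ firstTime p ↔ ∀ i < n, ¬ p i := by
  simp only [firstTime, le_iInf_iff, Nat.cast_le]
  exact ⟨fun h i hi hp => absurd (h i hp) (not_le.2 hi), fun h i hp =>
    not_lt.1 fun hi => h i hi hp⟩

theorem firstTime_lt_iff {p : ℕ → Prop} {n : ℕ} : firstTime p < n ↔ ∃ i < n, p i := by
  rw [← not_le, le_firstTime_iff]; push Not; rfl

theorem firstTime_eq_iff {p : ℕ → Prop} {n : ℕ} :
    firstTime p = n ↔ p n ∧ ∀ i < n, ¬ p i := by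
  have h1 : firstTime p ≤ n ↔ ∃ i ≤ n, p i := by
    have := firstTime_lt_iff (p := p) (n := n + 1)
    rw [Nat.cast_add, Nat.cast_one, ENat.lt_add_one_iff (ENat.natCast_ne_top n)] at this
    simpa [Nat.lt_succ_iff] using this
  rw [le_antisymm_iff, h1, le_firstTime_iff]
  constructor
  · rintro ⟨⟨i, hi, hp⟩, h⟩
    obtain rfl : i = n := hi.antisymm (not_lt.1 fun h' => h i h' hp)
    exact ⟨hp, h⟩
  · rintro ⟨hp, h⟩
    exact ⟨⟨n, le_rfl, hp⟩, h⟩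

theorem firstTime_eq_top_iff {p : ℕ → Prop} : firstTime p = ⊤ ↔ ∀ i, ¬ p i := by
  simp [firstTime, iInf_eq_top]

theorem eq_of_forall_coe_le_iff {a b : ℕ∞} (h : ∀ n : ℕ, (n : ℕ∞) ≤ a ↔ (n : ℕ∞) ≤ b) : a = b :=
  ENat.eq_of_forall_natCast_le_iff h

theorem coe_le_add_iff {a : ℕ∞} {n k : ℕ} : (n : ℕ∞) ≤ a + k ↔ ((n - k : ℕ) : ℕ∞) ≤ a := by
  rw [ENat.natCast_sub, tsub_le_iff_right]

theorem firstTime_shift {p : ℕ → Prop} {k : ℕ} (h : ∀ i < k, ¬ p i) :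
    firstTime p = firstTime (fun i => p (i + k)) + k := by
  refine eq_of_forall_coe_le_iff fun n => ?_
  rw [coe_le_add_iff, le_firstTime_iff, le_firstTime_iff]
  constructor
  · exact fun H i hi => H _ (by omega)
  · intro H i hi hp
    have hik : k ≤ i := not_lt.1 fun hlt => h i hlt hp
    exact H (i - k) (by omega) (by rwa [Nat.sub_add_cancel hik])

theorem regen_zero_eq (y : ℕ → Bool) : regen y 0 = firstTime fun t => y t = true := by
  rw [regen]; rfl

theorem regen_succ_eq (y : ℕ → Bool) (k : ℕ) :
    regen y (k + 1) = firstTime fun t => y t = true ∧ regen y k < t := by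
  rw [regen]; rfl

theorem regen_eq_coe {y : ℕ → Bool} {k t : ℕ} (h : regen y k = t) : y t = true := by
  cases k with
  | zero => rw [regen_zero_eq, firstTime_eq_iff] at h; exact h.1
  | succ k => rw [regen_succ_eq, firstTime_eq_iff] at h; exact h.1.1

theorem coe_lt_regen_succ {y : ℕ → Bool} {k t : ℕ} (h : regen y k = t) :
    ((t + 1 : ℕ) : ℕ∞) ≤ regen y (k + 1) := by
  rw [regen_succ_eq, le_firstTime_iff]
  rintro i hi ⟨-, h'⟩
  rw [h, Nat.cast_lt] at h'
  omega

theorem regen_eq_of_mem_block {y : ℕ → Bool} {k t : ℕ} (h : t ∈ block y k) (ht : y t = true) :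
    regen y k = t := by
  cases k with
  | zero =>
    have h' : (t : ℕ∞) ≤ regen y 0 := h
    rw [regen_zero_eq] at h' ⊢
    exact firstTime_eq_iff.2 ⟨ht, le_firstTime_iff.1 h'⟩
  | succ k =>
    obtain ⟨h1, h2⟩ : regen y k < t ∧ (t : ℕ∞) ≤ regen y (k + 1) := h
    rw [regen_succ_eq] at h2 ⊢
    exact firstTime_eq_iff.2 ⟨⟨ht, h1⟩, le_firstTime_iff.1 h2⟩

theorem succ_mem_block {y : ℕ → Bool} {k t : ℕ} (h : t ∈ block y k) (ht : y t = false) :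
    t + 1 ∈ block y k := by
  have key : (t : ℕ∞) ≤ regen y k → ((t + 1 : ℕ) : ℕ∞) ≤ regen y k := fun h' => by
    have hne : (t : ℕ∞) ≠ regen y k := fun he => by
      simp [regen_eq_coe he.symm] at ht
    simpa using Order.add_one_le_of_lt (lt_of_le_of_ne h' hne)
  cases k with
  | zero => exact key h
  | succ k =>
    exact ⟨lt_trans h.1 (by exact_mod_cast Nat.lt_succ_self t), key h.2⟩

theorem succ_mem_block_succ {y : ℕ → Bool} {k t : ℕ} (h : t ∈ block y k) (ht : y t = true) :
    t + 1 ∈ block y (k + 1) := by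
  have hr := regen_eq_of_mem_block h ht
  refine ⟨?_, coe_lt_regen_succ hr⟩
  rw [hr]
  exact_mod_cast Nat.lt_succ_self t

/-- The renewal structure, path by path: discarding the times up to and including the first
regeneration lowers the index of every later regeneration by one. -/
theorem regen_of_first {y : ℕ → Bool} {n : ℕ} (hn : regen y 0 = n) (k : ℕ) :
    regen y (k + 1) = regen (fun i => y (i + (n + 1))) k + ((n + 1 : ℕ) : ℕ∞) := by
  induction k with
  | zero =>
    rw [regen_succ_eq, hn, firstTime_shift (k := n + 1), regen_zero_eq]
    · congr 2
      ext i
      simp only [Nat.cast_lt, and_iff_left_iff_imp]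
      omega
    · rintro i hi ⟨-, h⟩
      rw [Nat.cast_lt] at h
      omega
  | succ k ih =>
    rw [regen_succ_eq, ih, firstTime_shift (k := n + 1), regen_succ_eq]
    · congr 2
      ext i
      rw [Nat.cast_add i, ENat.add_lt_add_iff_right (ENat.natCast_ne_top _)]
    · rintro i hi ⟨-, h⟩
      have h' : ((n + 1 : ℕ) : ℕ∞) < i := le_add_self.trans_lt h
      rw [Nat.cast_lt] at h'
      omega

theorem regen_of_first_false {y : ℕ → Bool} (h : y 0 = false) (k : ℕ) :
    regen y k = regen (fun i => y (i + 1)) k + ((1 : ℕ) : ℕ∞) := by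
  induction k with
  | zero =>
    rw [regen_zero_eq, regen_zero_eq, firstTime_shift (k := 1)]
    intro i hi
    obtain rfl : i = 0 := by omega
    simp [h]
  | succ k ih =>
    rw [regen_succ_eq, ih, firstTime_shift (k := 1), regen_succ_eq]
    · congr 2
      ext i
      rw [Nat.cast_add i, ENat.add_lt_add_iff_right (ENat.natCast_ne_top _)]
    · rintro i hi ⟨h', -⟩
      obtain rfl : i = 0 := by omega
      simp [h] at h'

theorem regen_succ_eq_top {y : ℕ → Bool} (h : regen y 0 = ⊤) (k : ℕ) : regen y k = ⊤ := by
  rw [regen_zero_eq, firstTime_eq_top_iff] at h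
  cases k with
  | zero => rwa [regen_zero_eq, firstTime_eq_top_iff]
  | succ k => rw [regen_succ_eq, firstTime_eq_top_iff]; exact fun i hi => h i hi.1

theorem mem_block_zero_iff {y : ℕ → Bool} {t : ℕ} : t ∈ block y 0 ↔ ∀ i < t, y i = false := by
  change (t : ℕ∞) ≤ regen y 0 ↔ _
  rw [regen_zero_eq, le_firstTime_iff]
  simp

theorem block_succ_eq_empty {y : ℕ → Bool} (h : regen y 0 = ⊤) (k : ℕ) : block y (k + 1) = ∅ := by
  ext t
  simp [block, regen_succ_eq_top h k]

theorem mem_block_succ_of_first {y : ℕ → Bool} {n : ℕ} (hn : regen y 0 = n) (k t : ℕ) :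
    t + (n + 1) ∈ block y (k + 1) ↔ t ∈ block (fun i => y (i + (n + 1))) k := by
  change regen y k < _ ∧ _ ≤ regen y (k + 1) ↔ _
  rw [regen_of_first hn k, Nat.cast_add t, ENat.add_le_add_iff_right (ENat.natCast_ne_top _)]
  cases k with
  | zero =>
    rw [hn]
    refine and_iff_right ?_
    rw [← Nat.cast_add, Nat.cast_lt]
    omega
  | succ k =>
    rw [regen_of_first hn k, ENat.add_lt_add_iff_right (ENat.natCast_ne_top _)]
    rfl

theorem not_mem_block_succ_of_first {y : ℕ → Bool} {n : ℕ} (hn : regen y 0 = n) (k : ℕ) {t : ℕ}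
    (ht : t < n + 1) : t ∉ block y (k + 1) := by
  rintro ⟨h, -⟩
  cases k with
  | zero => rw [hn, Nat.cast_lt] at h; omega
  | succ k =>
    rw [regen_of_first hn k] at h
    have h' : ((n + 1 : ℕ) : ℕ∞) < t := le_add_self.trans_lt h
    rw [Nat.cast_lt] at h'
    omega

theorem mem_block_of_first_false {y : ℕ → Bool} (h : y 0 = false) (k t : ℕ) :
    t + 1 ∈ block y k ↔ t ∈ block (fun i => y (i + 1)) k := by
  cases k with
  | zero =>
    change ((t + 1 : ℕ) : ℕ∞) ≤ regen y 0 ↔ (t : ℕ∞) ≤ regen (fun i => y (i + 1)) 0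
    rw [regen_of_first_false h, Nat.cast_add t, ENat.add_le_add_iff_right (ENat.natCast_ne_top _)]
  | succ k =>
    change regen y k < ((t + 1 : ℕ) : ℕ∞) ∧ ((t + 1 : ℕ) : ℕ∞) ≤ regen y (k + 1) ↔
      regen (fun i => y (i + 1)) k < t ∧ (t : ℕ∞) ≤ regen (fun i => y (i + 1)) (k + 1)
    rw [regen_of_first_false h, regen_of_first_false h, Nat.cast_add t,
      ENat.add_le_add_iff_right (ENat.natCast_ne_top _), ENat.add_lt_add_iff_right (ENat.natCast_ne_top _)]

/-! ### Sums over the blocks -/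

/-- The sum of `f` over the `k`-th block of the times of `y`. -/
def blockTsum (y : ℕ → Bool) (f : ℕ → ℝ≥0∞) (k : ℕ) : ℝ≥0∞ := ∑' t, (block y k).indicator f t

theorem blockTsum_succ_of_top {y : ℕ → Bool} (h : regen y 0 = ⊤) (f : ℕ → ℝ≥0∞) (k : ℕ) :
    blockTsum y f (k + 1) = 0 := by
  simp [blockTsum, block_succ_eq_empty h]

theorem blockTsum_succ_of_first {y : ℕ → Bool} {n : ℕ} (hn : regen y 0 = n) (f : ℕ → ℝ≥0∞)
    (k : ℕ) : blockTsum y f (k + 1) =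
      blockTsum (fun i => y (i + (n + 1))) (fun i => f (i + (n + 1))) k := by
  rw [blockTsum, ← Summable.sum_add_tsum_nat_add' (k := n + 1) ENNReal.summable,
    Finset.sum_eq_zero, zero_add, blockTsum]
  · refine tsum_congr fun t => ?_
    by_cases h : t ∈ block (fun i => y (i + (n + 1))) k
    · rw [Set.indicator_of_mem h, Set.indicator_of_mem ((mem_block_succ_of_first hn k t).2 h)]
    · rw [Set.indicator_of_notMem h,
        Set.indicator_of_notMem (mt (mem_block_succ_of_first hn k t).1 h)]
  · intro t ht
    exact Set.indicator_of_notMem (not_mem_block_succ_of_first hn k (Finset.mem_range.1 ht)) _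

theorem blockTsum_succ_of_first_false {y : ℕ → Bool} (h : y 0 = false) (f : ℕ → ℝ≥0∞)
    (k : ℕ) : blockTsum y f (k + 1) =
      blockTsum (fun i => y (i + 1)) (fun i => f (i + 1)) (k + 1) := by
  rw [blockTsum, tsum_eq_zero_add' ENNReal.summable, Set.indicator_of_notMem, zero_add, blockTsum]
  · refine tsum_congr fun t => ?_
    have := mem_block_of_first_false h (k + 1) t
    by_cases h : t ∈ block (fun i => y (i + 1)) (k + 1)
    · rw [Set.indicator_of_mem h, Set.indicator_of_mem (this.2 h)]
    · rw [Set.indicator_of_notMem h, Set.indicator_of_notMem (mt this.1 h)]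
  · rintro ⟨h', -⟩
    exact absurd h' (by simp)

/-! ### Measurability -/

theorem measurable_firstTime {Ω : Type*} [MeasurableSpace Ω] {p : Ω → ℕ → Prop}
    (hp : ∀ t, MeasurableSet {ω | p ω t}) : Measurable fun ω => firstTime (p ω) := by
  rw [ENat.measurable_iff]
  intro n
  have : (fun ω => firstTime (p ω)) ⁻¹' {(n : ℕ∞)} =
      {ω | p ω n} ∩ ⋂ i ∈ Finset.range n, {ω | p ω i}ᶜ := by
    ext ω
    simp [firstTime_eq_iff]
  rw [this]
  exact (hp n).inter (Finset.measurableSet_biInter _ fun i _ => (hp i).compl)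

theorem measurable_regen (k : ℕ) : Measurable fun y : ℕ → Bool => regen y k := by
  have h (t : ℕ) : MeasurableSet {y : ℕ → Bool | y t = true} :=
    (measurable_pi_apply (X := fun _ : ℕ => Bool) t) (measurableSet_singleton true)
  induction k with
  | zero => simp_rw [regen_zero_eq]; exact measurable_firstTime h
  | succ k ih =>
    simp_rw [regen_succ_eq]
    exact measurable_firstTime fun t => (h t).inter (ih (MeasurableSet.of_discrete (s := Set.Iio _)))

theorem measurableSet_mem_block (k t : ℕ) : MeasurableSet {y : ℕ → Bool | t ∈ block y k} := by
  cases k with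
  | zero => exact measurable_regen 0 (MeasurableSet.of_discrete (s := Set.Ici _))
  | succ k =>
    exact (measurable_regen k (MeasurableSet.of_discrete (s := Set.Iio _))).inter
      (measurable_regen (k + 1) (MeasurableSet.of_discrete (s := Set.Ici _)))

theorem measurable_blockTsum {Ω : Type*} [MeasurableSpace Ω] {y : Ω → ℕ → Bool}
    {f : Ω → ℕ → ℝ≥0∞} (hy : Measurable y) (hf : Measurable f) (k : ℕ) :
    Measurable fun ω => blockTsum (y ω) (f ω) k := by
  refine Measurable.tsum fun t => ?_
  exact ((measurable_pi_apply t).comp hf).indicator (hy (measurableSet_mem_block k t))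

/-! ### Moments of additive functionals over the first block -/

/-- A mean value inequality. Applied along a sum it telescopes: S^{q+1} is at most (q+1) ∑_t a_t
S_t^q, where S_t is the part of the sum from time t on. -/
theorem add_pow_succ_le (a b : ℝ≥0∞) (q : ℕ) :
    (a + b) ^ (q + 1) ≤ b ^ (q + 1) + (q + 1 : ℕ) * (a * (a + b) ^ q) := by
  induction q with
  | zero => simp [add_comm]
  | succ q ih =>
    calc (a + b) ^ (q + 1 + 1) = a * (a + b) ^ (q + 1) + b * (a + b) ^ (q + 1) := by ring
      _ ≤ a * (a + b) ^ (q + 1) + b * (b ^ (q + 1) + (q + 1 : ℕ) * (a * (a + b) ^ q)) := by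
        gcongr
      _ = b ^ (q + 1 + 1) + a * (a + b) ^ (q + 1) + (q + 1 : ℕ) * a * (b * (a + b) ^ q) := by
        ring
      _ ≤ b ^ (q + 1 + 1) + a * (a + b) ^ (q + 1) +
          (q + 1 : ℕ) * a * ((a + b) * (a + b) ^ q) := by
        gcongr
        exact le_add_self
      _ = b ^ (q + 1 + 1) + (q + 1 + 1 : ℕ) * (a * (a + b) ^ (q + 1)) := by
        push_cast; ring

/-- The sum of `f` over those times of the first block that are less than `n`. -/
def firstBlockSum (y : ℕ → Bool) (f : ℕ → ℝ≥0∞) (n : ℕ) : ℝ≥0∞ :=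
  ∑ t ∈ Finset.range n, (block y 0).indicator f t

theorem firstBlockSum_succ (y : ℕ → Bool) (f : ℕ → ℝ≥0∞) (n : ℕ) :
    firstBlockSum y f (n + 1) =
      f 0 + if y 0 then 0 else firstBlockSum (fun i => y (i + 1)) (fun i => f (i + 1)) n := by
  rw [firstBlockSum, Finset.sum_range_succ', add_comm,
    Set.indicator_of_mem (mem_block_zero_iff.2 (by simp))]
  congr 1
  split_ifs with h
  · refine Finset.sum_eq_zero fun t _ => Set.indicator_of_notMem (fun ht => ?_) _
    simp [mem_block_zero_iff.1 ht 0 (Nat.succ_pos t)] at h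
  · refine Finset.sum_congr rfl fun t _ => ?_
    have := mem_block_of_first_false (eq_false_of_ne_true h) 0 t
    by_cases h : t ∈ block (fun i => y (i + 1)) 0
    · rw [Set.indicator_of_mem h, Set.indicator_of_mem (this.2 h)]
    · rw [Set.indicator_of_notMem h, Set.indicator_of_notMem (mt this.1 h)]

theorem firstBlockSum_le (y : ℕ → Bool) (f : ℕ → ℝ≥0∞) (n : ℕ) :
    firstBlockSum y f n ≤ blockTsum y f 0 :=
  ENNReal.sum_le_tsum _

theorem measurable_firstBlockSum {Ω : Type*} [MeasurableSpace Ω] {y : Ω → ℕ → Bool}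
    {f : Ω → ℕ → ℝ≥0∞} (hy : Measurable y) (hf : Measurable f) (n : ℕ) :
    Measurable fun ω => firstBlockSum (y ω) (f ω) n :=
  Finset.measurable_sum _ fun t _ =>
    ((measurable_pi_apply t).comp hf).indicator (hy (measurableSet_mem_block 0 t))

/-- The trajectory of the auxiliary chain `Y`. -/
abbrev coins {E : Type*} (ω : ℕ → E × Bool) : ℕ → Bool := fun i => (ω i).2

/-- The values of `a` along the trajectory of `X`. -/
abbrev values {E : Type*} (a : E → ℝ≥0∞) (ω : ℕ → E × Bool) : ℕ → ℝ≥0∞ := fun i => a (ω i).1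

section

variable {E : Type*} [MeasurableSpace E]

theorem measurable_coins : Measurable (coins (E := E)) :=
  measurable_pi_lambda _ fun i => measurable_snd.comp (measurable_pi_apply i)

theorem measurable_values {a : E → ℝ≥0∞} (ha : Measurable a) : Measurable (values a) :=
  measurable_pi_lambda _ fun i => ha.comp (measurable_fst.comp (measurable_pi_apply i))

namespace AtomicChain

variable (c : AtomicChain E)

theorem lintegral_path_start (x : E) {F : E → (ℕ → E × Bool) → ℝ≥0∞}
    (hF : Measurable (Function.uncurry F)) :
    ∫⁻ ω, F (ω 0).1 ω ∂c.path x = ∫⁻ ω, F x ω ∂c.path x := by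
  have h1 : Measurable fun ω : ℕ → E × Bool => F (ω 0).1 ω :=
    hF.comp ((measurable_fst.comp (measurable_pi_apply 0)).prodMk measurable_id)
  have h2 : Measurable fun ω : ℕ → E × Bool => F x ω := hF.comp measurable_prodMk_left
  rw [c.lintegral_path_step x h1, c.lintegral_path_step x h2]
  rfl

/-- The `q`-th moment of the sum of `a` over the first block, as a function of the starting
point. -/
def blockMoment (a : E → ℝ≥0∞) (q : ℕ) (x : E) : ℝ≥0∞ :=
  ∫⁻ ω, blockTsum (coins ω) (values a ω) 0 ^ q ∂c.path x

theorem measurable_blockMoment {a : E → ℝ≥0∞} (ha : Measurable a) (q : ℕ) :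
    Measurable (c.blockMoment a q) :=
  ((measurable_blockTsum measurable_coins (measurable_values ha) 0).pow_const q).lintegral_kernel

/-- Truncation at a finite horizon permits induction by first steps: the rest of the sum is a
truncated block sum of the chain moved by H, and the extra term is a(x) times the lower moment at x.
Unrolling the recursion produces the potential G. -/
theorem lintegral_firstBlockSum_le {a : E → ℝ≥0∞} (ha : Measurable a) (q n : ℕ) (x : E) :
    ∫⁻ ω, firstBlockSum (coins ω) (values a ω) n ^ (q + 1) ∂c.path x ≤
      (q + 1 : ℕ) * ∫⁻ y, a y * c.blockMoment a q y ∂c.G x := by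
  have hf : Measurable fun y => a y * c.blockMoment a q y := ha.mul (c.measurable_blockMoment ha q)
  induction n generalizing x with
  | zero => simp [firstBlockSum]
  | succ n ih =>
    have hS (n : ℕ) : Measurable fun ω => firstBlockSum (coins ω) (values a ω) n :=
      measurable_firstBlockSum measurable_coins (measurable_values ha) n
    have hshift : Measurable fun (ω : ℕ → E × Bool) (i : ℕ) => ω (i + 1) :=
      measurable_pi_lambda _ fun i => measurable_pi_apply _
    let R : (ℕ → E × Bool) → ℝ≥0∞ := fun ω =>
      if (ω 0).2 then 0 else firstBlockSum (coins fun i => ω (i + 1)) (values a fun i => ω (i + 1)) n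
    have hR : Measurable R := Measurable.ite
      ((measurable_snd.comp (measurable_pi_apply 0)) (measurableSet_singleton true))
      measurable_const ((hS n).comp hshift)
    have hstep : ∀ ω : ℕ → E × Bool,
        firstBlockSum (coins ω) (values a ω) (n + 1) = a (ω 0).1 + R ω :=
      fun ω => firstBlockSum_succ _ _ _
    calc ∫⁻ ω, firstBlockSum (coins ω) (values a ω) (n + 1) ^ (q + 1) ∂c.path x
        ≤ ∫⁻ ω, R ω ^ (q + 1) + (q + 1 : ℕ) *
            (a (ω 0).1 * blockTsum (coins ω) (values a ω) 0 ^ q) ∂c.path x := by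
          refine lintegral_mono fun ω => ?_
          have h := add_pow_succ_le (a (ω 0).1) (R ω) q
          rw [← hstep] at h
          refine h.trans ?_
          gcongr
          exact firstBlockSum_le _ _ _
      _ = ∫⁻ y, ∫⁻ ω, firstBlockSum (coins ω) (values a ω) n ^ (q + 1) ∂c.path y ∂c.H x +
            (q + 1 : ℕ) * (a x * c.blockMoment a q x) := by
          have hB := (measurable_blockTsum measurable_coins (measurable_values ha) 0).pow_const q
          rw [lintegral_add_left (hR.pow_const _)]
          congr 1
          · rw [c.lintegral_path_step x (hR.pow_const _)]
            simp [R]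
          · rw [c.lintegral_path_start x
              (F := fun x ω => (q + 1 : ℕ) * (a x * blockTsum (coins ω) (values a ω) 0 ^ q)),
              lintegral_const_mul _ (hB.const_mul _), lintegral_const_mul _ hB]
            · rfl
            · exact ((ha.comp measurable_fst).mul (hB.comp measurable_snd)).const_mul _
      _ ≤ ∫⁻ y, (q + 1 : ℕ) * ∫⁻ z, a z * c.blockMoment a q z ∂c.G y ∂c.H x +
            (q + 1 : ℕ) * (a x * c.blockMoment a q x) := by
          gcongr with y
          exact ih y
      _ = (q + 1 : ℕ) * ∫⁻ y, a y * c.blockMoment a q y ∂c.G x := by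
          rw [lintegral_const_mul _ hf.lintegral_kernel, ← mul_add, c.lintegral_G_step x hf,
            add_comm (a x * _)]

/-- Monotone convergence removes the horizon. -/
theorem blockMoment_succ_le {a : E → ℝ≥0∞} (ha : Measurable a) (q : ℕ) (x : E) :
    c.blockMoment a (q + 1) x ≤ (q + 1 : ℕ) * ∫⁻ y, a y * c.blockMoment a q y ∂c.G x := by
  have hS (n : ℕ) : Measurable fun ω => firstBlockSum (coins ω) (values a ω) n ^ (q + 1) :=
    (measurable_firstBlockSum measurable_coins (measurable_values ha) n).pow_const _
  have ht := lintegral_tendsto_of_tendsto_of_monotone (μ := c.path x)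
    (F := fun ω => blockTsum (coins ω) (values a ω) 0 ^ (q + 1)) (fun n => (hS n).aemeasurable)
    (ae_of_all _ fun ω n m hnm => pow_le_pow_left' (Finset.sum_le_sum_of_subset
      (Finset.range_mono hnm)) _)
    (ae_of_all _ fun ω => (ENNReal.continuous_pow _).tendsto _ |>.comp
      ENNReal.summable.hasSum.tendsto_sum_nat)
  exact le_of_tendsto' ht fun n => c.lintegral_firstBlockSum_le ha q n x

/-- Khas'minskii's argument: a uniform bound on the potential of the support bounds all moments
uniformly, each use of the recursion contributing one factor A C. -/
theorem blockMoment_le {a : E → ℝ≥0∞} (ha : Measurable a) {B : Set E} (hB : MeasurableSet B)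
    {A C : ℝ≥0∞} (haB : ∀ y, a y ≤ B.indicator (fun _ => A) y) (hC : ∀ x, c.G x B ≤ C) (q : ℕ)
    (x : E) : c.blockMoment a q x ≤ q.factorial * (A * C) ^ q := by
  induction q generalizing x with
  | zero => simp [blockMoment]
  | succ q ih =>
    calc c.blockMoment a (q + 1) x
        ≤ (q + 1 : ℕ) * ∫⁻ y, a y * c.blockMoment a q y ∂c.G x := c.blockMoment_succ_le ha q x
      _ ≤ (q + 1 : ℕ) * ∫⁻ y, B.indicator (fun _ => A) y * (q.factorial * (A * C) ^ q) ∂c.G x := by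
          gcongr with y
          · exact haB y
          · exact ih y
      _ = (q + 1 : ℕ) * (A * c.G x B * (q.factorial * (A * C) ^ q)) := by
          rw [lintegral_mul_const _ (measurable_const.indicator hB), lintegral_indicator_const hB]
      _ ≤ (q + 1 : ℕ) * (A * C * (q.factorial * (A * C) ^ q)) := by
          gcongr
          exact hC x
      _ = (q + 1).factorial * (A * C) ^ (q + 1) := by
          rw [Nat.factorial_succ]; push_cast; ring

/-- In the outermost use of the recursion, integration against ν turns G into π_s, so one factor `C`
is replaced by `c.piS B`. For a shrinking set B this is where the gain of one power of h comes from.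
-/
theorem lintegral_blockMoment_le {a : E → ℝ≥0∞} (ha : Measurable a) {B : Set E}
    (hB : MeasurableSet B) {A C : ℝ≥0∞} (haB : ∀ y, a y ≤ B.indicator (fun _ => A) y)
    (hC : ∀ x, c.G x B ≤ C) (q : ℕ) :
    ∫⁻ x, c.blockMoment a (q + 1) x ∂c.ν ≤
      (q + 1).factorial * A ^ (q + 1) * C ^ q * c.piS B := by
  calc ∫⁻ x, c.blockMoment a (q + 1) x ∂c.ν
      ≤ ∫⁻ x, (q + 1 : ℕ) * ∫⁻ y, B.indicator (fun _ => A) y * (q.factorial * (A * C) ^ q) ∂c.G x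
          ∂c.ν := by
        refine lintegral_mono fun x => (c.blockMoment_succ_le ha q x).trans ?_
        gcongr with y
        · exact haB y
        · exact c.blockMoment_le ha hB haB hC q y
    _ = (q + 1 : ℕ) * (A * c.piS B * (q.factorial * (A * C) ^ q)) := by
        have hm : Measurable (B.indicator fun _ => A) := measurable_const.indicator hB
        rw [lintegral_const_mul _ (hm.mul_const _).lintegral_kernel,
          ← c.lintegral_piS (hm.mul_const _), lintegral_mul_const _ hm,
          lintegral_indicator_const hB]
    _ = (q + 1).factorial * A ^ (q + 1) * C ^ q * c.piS B := by
        rw [Nat.factorial_succ]; push_cast; ring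

/-- The potential of a small set is bounded. -/
theorem exists_G_le_of_isSmallSet {φ : Measure E} (hirr : c.IsIrred φ) {N : Set E}
    (hN : IsSmallSet φ c.P N) : ∃ C : ℝ≥0, ∀ x, c.G x N ≤ C := by
  obtain ⟨hNm, ⟨-, hpos⟩, l, b, m, hl, hb, -, hlP⟩ := hN
  have hφ := hirr.2.1
  have hs (r : ℕ) : Measurable fun y => ∫⁻ z, c.s z ∂(c.P ^ r) y :=
    c.measurable_s.lintegral_kernel
  -- If l P^r s vanished for every r, some point y would satisfy P^r s(y) = 0 for all r, so {s > 0}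
  -- would be unreachable from y, against irreducibility.
  obtain ⟨r, hr⟩ : ∃ r : ℕ, ∫⁻ y, ∫⁻ z, c.s z ∂(c.P ^ r) y ∂l ≠ 0 := by
    by_contra! h
    have h' : ∀ᵐ y ∂l, ∀ r, ∫⁻ z, c.s z ∂(c.P ^ r) y = 0 :=
      ae_all_iff.2 fun r => (lintegral_eq_zero_iff (hs r)).1 (h r)
    have : (ae l).NeBot := ae_neBot.2 hl
    obtain ⟨y, hy⟩ := h'.exists
    obtain ⟨n, hn⟩ := hφ.irreducible (measurableSet_lt measurable_const c.measurable_s)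
      hirr.2.2.2 y
    have h0 := (lintegral_eq_zero_iff c.measurable_s).1 (hy n)
    refine hn.ne' (measure_mono_null (fun z hz => ?_) h0)
    exact (show 0 < c.s z from hz).ne'
  -- Smallness gives P^{r+m} s ≥ d on N, hence d G(x,N) ≤ G P^{r+m} s(x) ≤ r + m + 1.
  set d : ℝ≥0∞ := b * ∫⁻ y, ∫⁻ z, c.s z ∂(c.P ^ r) y ∂l
  have hd0 : d ≠ 0 := mul_ne_zero hb.ne' hr
  have hdN : ∀ y ∈ N, d ≤ ∫⁻ z, c.s z ∂(c.P ^ (r + m)) y := fun y hy => by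
    have h1 := lintegral_mono' (hlP y) (le_refl fun y => ∫⁻ z, c.s z ∂(c.P ^ r) y)
    rw [Set.indicator_of_mem hy, Pi.one_apply, mul_one, lintegral_smul_measure] at h1
    rw [pow_add]
    exact h1.trans_eq (Kernel.lintegral_comp _ _ _ c.measurable_s).symm
  have hdtop : d ≠ ⊤ := by
    obtain ⟨y, hy⟩ := nonempty_of_measure_ne_zero hpos.ne'
    have hy : y ∈ N := by
      by_contra h
      simp [h] at hy
    refine ne_top_of_le_ne_top ENNReal.one_ne_top ((hdN y hy).trans ?_)
    rw [← c.lintegral_path_apply y _ c.measurable_s]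
    exact (lintegral_mono fun ω => c.s_le_one _).trans (by simp)
  have hfin : ((r + m : ℕ) + 1 : ℝ≥0∞) / d ≠ ⊤ :=
    ENNReal.div_ne_top (by finiteness) hd0
  refine ⟨(((r + m : ℕ) + 1 : ℝ≥0∞) / d).toNNReal, fun x => ?_⟩
  rw [ENNReal.coe_toNNReal hfin, ENNReal.le_div_iff_mul_le (.inl hd0) (.inl hdtop)]
  calc c.G x N * d = ∫⁻ y, N.indicator (fun _ => d) y ∂c.G x := by
        rw [lintegral_indicator_const hNm, mul_comm]
    _ ≤ ∫⁻ y, ∫⁻ z, c.s z ∂(c.P ^ (r + m)) y ∂c.G x := by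
        refine lintegral_mono fun y => ?_
        by_cases hy : y ∈ N
        · rw [Set.indicator_of_mem hy]; exact hdN y hy
        · rw [Set.indicator_of_notMem hy]; exact zero_le
    _ ≤ (r + m : ℕ) + 1 := c.lintegral_G_P_pow_s_le x (r + m)

theorem piS_le_of_G_le {N : Set E} (hN : MeasurableSet N) {C : ℝ≥0∞} (hC : ∀ x, c.G x N ≤ C) :
    c.piS N ≤ C := by
  have h : ∫⁻ y, N.indicator 1 y ∂c.piS = ∫⁻ x, ∫⁻ y, N.indicator 1 y ∂c.G x ∂c.ν :=
    c.lintegral_piS (measurable_one.indicator hN)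
  simp_rw [lintegral_indicator_one hN] at h
  rw [h]
  exact (lintegral_mono hC).trans (by simp)

end AtomicChain

end

/-! ### The chain observed at the regeneration times of an independent chain -/

/-- The trajectory from time `k` on. -/
def shiftPath {S : Type*} (k : ℕ) (ω : ℕ → S) : ℕ → S := fun i => ω (i + k)

@[fun_prop]
theorem measurable_shiftPath {S : Type*} [MeasurableSpace S] (k : ℕ) :
    Measurable (shiftPath (S := S) k) :=
  measurable_pi_lambda _ fun _ => measurable_pi_apply _

/-- The trajectories of the split chain whose first regeneration occurs at time `n`. -/
def firstRegenAt (E : Type*) (n : ℕ) : Set (ℕ → E × Bool) := {ω | regen (coins ω) 0 = n}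

theorem mem_firstRegenAt_iff {E : Type*} {n : ℕ} {ω : ℕ → E × Bool} :
    ω ∈ firstRegenAt E n ↔ (ω n).2 = true ∧ ∀ i < n, ¬ (ω i).2 = true := by
  rw [firstRegenAt, Set.mem_ofPred_eq, regen_zero_eq, firstTime_eq_iff]

theorem measurableSet_firstRegenAt {E : Type*} [MeasurableSpace E] (n : ℕ) :
    MeasurableSet (firstRegenAt E n) :=
  (measurable_regen 0).comp measurable_coins (measurableSet_singleton _)

theorem pathCons_true_mem_firstRegenAt_zero {E : Type*} (x : E) (ω : ℕ → E × Bool) :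
    pathCons (x, true) ω ∈ firstRegenAt E 0 := by
  simp [mem_firstRegenAt_iff]

theorem pathCons_false_notMem_firstRegenAt_zero {E : Type*} (x : E) (ω : ℕ → E × Bool) :
    pathCons (x, false) ω ∉ firstRegenAt E 0 := by
  simp [mem_firstRegenAt_iff]

theorem pathCons_true_notMem_firstRegenAt_succ {E : Type*} (x : E) (ω : ℕ → E × Bool) (n : ℕ) :
    pathCons (x, true) ω ∉ firstRegenAt E (n + 1) := by
  rw [mem_firstRegenAt_iff]
  rintro ⟨-, h⟩
  exact h 0 (Nat.succ_pos n) rfl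

theorem pathCons_false_mem_firstRegenAt_succ {E : Type*} (x : E) (ω : ℕ → E × Bool) (n : ℕ) :
    pathCons (x, false) ω ∈ firstRegenAt E (n + 1) ↔ ω ∈ firstRegenAt E n := by
  rw [mem_firstRegenAt_iff, mem_firstRegenAt_iff]
  refine and_congr_right fun _ => ⟨fun h i hi => h (i + 1) (by omega), fun h i hi => ?_⟩
  cases i with
  | zero => simp
  | succ i => exact h i (by omega)

namespace AtomicChain

variable {E : Type*} [MeasurableSpace E] (c : AtomicChain E)

/-- The strong Markov property at the first regeneration time. -/
theorem lintegral_path_firstRegenAt (n : ℕ) (x : E) {F : (ℕ → E × Bool) → ℝ≥0∞}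
    (hF : Measurable F) :
    ∫⁻ ω, (firstRegenAt E n).indicator (fun ω => F (shiftPath (n + 1) ω)) ω ∂c.path x =
      (∫⁻ y, c.s y ∂(c.H ^ n) x) * ∫⁻ ω, F ω ∂c.splitLaw c.ν := by
  have hm (n : ℕ) : Measurable
      ((firstRegenAt E n).indicator fun ω => F (shiftPath (n + 1) ω)) :=
    (hF.comp (measurable_shiftPath _)).indicator (measurableSet_firstRegenAt n)
  induction n generalizing x with
  | zero =>
    rw [c.lintegral_path_step x (hm 0), pow_zero]
    simp only [Set.indicator_of_mem (pathCons_true_mem_firstRegenAt_zero x _),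
      Set.indicator_of_notMem (pathCons_false_notMem_firstRegenAt_zero x _), lintegral_zero,
      add_zero]
    rw [c.lintegral_splitLaw _ hF]
    congr 1
    exact (lintegral_dirac' _ c.measurable_s).symm
  | succ n ih =>
    rw [c.lintegral_path_step x (hm (n + 1)), lintegral_pow_succ' _ _ _ c.measurable_s,
      ← lintegral_mul_const _ c.measurable_s.lintegral_kernel]
    simp only [Set.indicator_of_notMem (pathCons_true_notMem_firstRegenAt_succ x _ n),
      lintegral_zero, mul_zero, zero_add]
    refine lintegral_congr fun y => ?_
    rw [← ih y]
    refine lintegral_congr fun ω => ?_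
    by_cases h : ω ∈ firstRegenAt E n
    · rw [Set.indicator_of_mem h,
        Set.indicator_of_mem ((pathCons_false_mem_firstRegenAt_succ x ω n).2 h)]
      rfl
    · rw [Set.indicator_of_notMem h,
        Set.indicator_of_notMem (mt (pathCons_false_mem_firstRegenAt_succ x ω n).1 h)]

/-- The Markov property at time `n` on the event that there is no regeneration at time `n`. -/
theorem lintegral_path_no_regen (n : ℕ) (x : E) {F : (ℕ → E × Bool) → ℝ≥0∞}
    (hF : Measurable F) :
    ∫⁻ ω, (if (ω n).2 = true then 0 else F (shiftPath (n + 1) ω)) ∂c.path x =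
      ∫⁻ z, ∫⁻ y, ∫⁻ ω, F ω ∂c.path y ∂c.H z ∂(c.P ^ n) x := by
  have hm (n : ℕ) : Measurable fun ω : ℕ → E × Bool =>
      if (ω n).2 = true then 0 else F (shiftPath (n + 1) ω) :=
    Measurable.ite ((measurable_snd.comp (measurable_pi_apply n)) (measurableSet_singleton true))
      measurable_const (hF.comp (measurable_shiftPath _))
  have hFk : Measurable fun z => ∫⁻ y, ∫⁻ ω, F ω ∂c.path y ∂c.H z :=
    hF.lintegral_kernel.lintegral_kernel
  induction n generalizing x with
  | zero =>
    rw [c.lintegral_path_step x (hm 0), pow_zero]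
    simp only [pathCons_zero, if_true, lintegral_zero, mul_zero, zero_add, Bool.false_eq_true,
      if_false]
    exact (lintegral_dirac' _ hFk).symm
  | succ n ih =>
    rw [lintegral_pow_succ' _ _ _ hFk]
    refine (c.lintegral_path_succ x (hm n)).trans (lintegral_congr fun y => ih y)

end AtomicChain

section Compound

variable {E₁ E₂ : Type*} [MeasurableSpace E₁] [MeasurableSpace E₂]
  (c₁ : AtomicChain E₁) (c₂ : AtomicChain E₂)

theorem lintegral_pairLaw (l₁ : Measure E₁) (l₂ : Measure E₂) [IsProbabilityMeasure l₁]
    [IsProbabilityMeasure l₂] {Φ : Path E₁ E₂ → ℝ≥0∞} (hΦ : Measurable Φ) :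
    ∫⁻ ω, Φ ω ∂pairLaw c₁ c₂ l₁ l₂ =
      ∫⁻ ω₁, ∫⁻ ω₂, Φ (ω₁, ω₂) ∂c₂.splitLaw l₂ ∂c₁.splitLaw l₁ := by
  rw [pairLaw, lintegral_prod _ hΦ.aemeasurable]

/-- The mean of `Φ` when the first chain starts from its regeneration measure, as a function of
the starting point of the second chain. -/
def pairMean (Φ : Path E₁ E₂ → ℝ≥0∞) (w : E₂) : ℝ≥0∞ :=
  ∫⁻ ω₂, ∫⁻ ω₁, Φ (ω₁, ω₂) ∂c₁.splitLaw c₁.ν ∂c₂.path w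

theorem measurable_pairMean {Φ : Path E₁ E₂ → ℝ≥0∞} (hΦ : Measurable Φ) :
    Measurable (pairMean c₁ c₂ Φ) :=
  hΦ.lintegral_prod_left'.lintegral_kernel

theorem lintegral_pairLaw_eq_pairMean {Φ : Path E₁ E₂ → ℝ≥0∞} (hΦ : Measurable Φ) :
    ∫⁻ ω, Φ ω ∂pairLaw c₁ c₂ c₁.ν c₂.ν = ∫⁻ w, pairMean c₁ c₂ Φ w ∂c₂.ν := by
  rw [lintegral_pairLaw c₁ c₂ _ _ hΦ,
    lintegral_lintegral_swap (f := fun ω₁ ω₂ => Φ (ω₁, ω₂)) hΦ.aemeasurable,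
    c₂.lintegral_splitLaw _ hΦ.lintegral_prod_left']
  rfl

/-- The functional that is `Φ` after time `n`, provided that the first regeneration of the first
chain takes place at time `n` and the second chain does not regenerate at this time. -/
def afterFirst (n : ℕ) (Φ : Path E₁ E₂ → ℝ≥0∞) (ω : Path E₁ E₂) : ℝ≥0∞ :=
  (firstRegenAt E₁ n).indicator (fun ω₁ =>
    if (ω.2 n).2 = true then 0 else Φ (shiftPath (n + 1) ω₁, shiftPath (n + 1) ω.2)) ω.1

theorem measurable_afterFirst (n : ℕ) {Φ : Path E₁ E₂ → ℝ≥0∞} (hΦ : Measurable Φ) :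
    Measurable (afterFirst n Φ) := by
  have h : Measurable fun ω : Path E₁ E₂ =>
      if (ω.2 n).2 = true then 0 else Φ (shiftPath (n + 1) ω.1, shiftPath (n + 1) ω.2) := by
    refine Measurable.ite ?_ measurable_const (by fun_prop)
    exact (measurable_snd.comp ((measurable_pi_apply n).comp measurable_snd))
      (measurableSet_singleton true)
  exact h.indicator (measurable_fst (measurableSet_firstRegenAt n))

/-- The probability that the first regeneration of the first chain takes place at time `n`. -/
def regenProb (c : AtomicChain E₁) (n : ℕ) : ℝ≥0∞ := ∫⁻ x, ∫⁻ y, c.s y ∂(c.H ^ n) x ∂c.ν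

theorem tsum_regenProb_le : ∑' n, regenProb c₁ n ≤ 1 := by
  simp_rw [regenProb]
  rw [← lintegral_tsum fun n => c₁.measurable_s.lintegral_kernel.aemeasurable]
  simp_rw [← c₁.lintegral_G]
  exact (lintegral_mono c₁.lintegral_G_s_le).trans (by simp)

theorem lintegral_splitLaw_firstRegenAt (n : ℕ) {F : (ℕ → E₁ × Bool) → ℝ≥0∞}
    (hF : Measurable F) :
    ∫⁻ ω, (firstRegenAt E₁ n).indicator (fun ω => F (shiftPath (n + 1) ω)) ω ∂c₁.splitLaw c₁.ν =
      regenProb c₁ n * ∫⁻ ω, F ω ∂c₁.splitLaw c₁.ν := by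
  have hm : Measurable ((firstRegenAt E₁ n).indicator fun ω => F (shiftPath (n + 1) ω)) :=
    (hF.comp (measurable_shiftPath _)).indicator (measurableSet_firstRegenAt n)
  rw [c₁.lintegral_splitLaw _ hm, regenProb,
    ← lintegral_mul_const _ c₁.measurable_s.lintegral_kernel]
  exact lintegral_congr fun x => c₁.lintegral_path_firstRegenAt n x hF

/-- By independence the regeneration time n of X is deterministic for W: W makes n free steps, then
one step by H since it does not regenerate at n, while X restarts from ν₁. -/
theorem pairMean_afterFirst (n : ℕ) {Φ : Path E₁ E₂ → ℝ≥0∞} (hΦ : Measurable Φ) (w : E₂) :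
    pairMean c₁ c₂ (afterFirst n Φ) w =
      regenProb c₁ n * ∫⁻ z, ∫⁻ v, pairMean c₁ c₂ Φ v ∂c₂.H z ∂(c₂.P ^ n) w := by
  have h (ω₂ : ℕ → E₂ × Bool) : ∫⁻ ω₁, afterFirst n Φ (ω₁, ω₂) ∂c₁.splitLaw c₁.ν =
      regenProb c₁ n * if (ω₂ n).2 = true then 0
        else ∫⁻ ω₁, Φ (ω₁, shiftPath (n + 1) ω₂) ∂c₁.splitLaw c₁.ν := by
    simp only [afterFirst]
    split_ifs with h
    · simp
    · exact lintegral_splitLaw_firstRegenAt c₁ n (F := fun ω₁ => Φ (ω₁, shiftPath (n + 1) ω₂))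
        (hΦ.comp measurable_prodMk_right)
  have hm : Measurable fun ω₂ => ∫⁻ ω₁, Φ (ω₁, ω₂) ∂c₁.splitLaw c₁.ν := hΦ.lintegral_prod_left'
  rw [pairMean, lintegral_congr h, lintegral_const_mul, c₂.lintegral_path_no_regen n w hm]
  · rfl
  · exact Measurable.ite
      ((measurable_snd.comp (measurable_pi_apply n)) (measurableSet_singleton true))
      measurable_const (hm.comp (measurable_shiftPath _))

/-- The transition operator, killed at regeneration, of the second chain observed after the
regeneration times of the first chain. -/
def embeddedOp (f : E₂ → ℝ≥0∞) (w : E₂) : ℝ≥0∞ :=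
  ∑' n, regenProb c₁ n * ∫⁻ z, ∫⁻ v, f v ∂c₂.H z ∂(c₂.P ^ n) w

theorem measurable_embeddedOp {f : E₂ → ℝ≥0∞} (hf : Measurable f) :
    Measurable (embeddedOp c₁ c₂ f) :=
  Measurable.tsum fun _ => hf.lintegral_kernel.lintegral_kernel.const_mul _

/-- Subinvariance removes each power of `c₂.P`, the weights sum to at most 1, and what remains is
π_s H = π_s - ν in additive form. -/
theorem lintegral_embeddedOp_le {f : E₂ → ℝ≥0∞} (hf : Measurable f) :
    ∫⁻ w, f w ∂c₂.ν + ∫⁻ w, embeddedOp c₁ c₂ f w ∂c₂.piS ≤ ∫⁻ w, f w ∂c₂.piS := by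
  rw [← c₂.lintegral_piS_step hf]
  refine add_le_add le_rfl ?_
  simp only [embeddedOp]
  rw [lintegral_tsum fun n => (hf.lintegral_kernel.lintegral_kernel.const_mul _).aemeasurable]
  calc ∑' n, ∫⁻ w, regenProb c₁ n * ∫⁻ z, ∫⁻ v, f v ∂c₂.H z ∂(c₂.P ^ n) w ∂c₂.piS
      ≤ ∑' n, regenProb c₁ n * ∫⁻ z, ∫⁻ v, f v ∂c₂.H z ∂c₂.piS := by
        refine ENNReal.tsum_le_tsum fun n => ?_
        rw [lintegral_const_mul _ hf.lintegral_kernel.lintegral_kernel]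
        refine mul_le_mul_right ?_ _
        exact c₂.lintegral_piS_P_pow_le n hf.lintegral_kernel
    _ ≤ _ := by
        rw [ENNReal.tsum_mul_right]
        exact mul_le_of_le_one_left' (tsum_regenProb_le c₁)

/-- The expected occupation measure of the embedded chain before its regeneration is dominated by
π_{s₂}: the preceding inequality is iterated, with f replaced by its image under the operator. -/
theorem tsum_lintegral_embeddedOp_iterate_le {f : E₂ → ℝ≥0∞} (hf : Measurable f) :
    ∑' j, ∫⁻ w, (embeddedOp c₁ c₂)^[j] f w ∂c₂.ν ≤ ∫⁻ w, f w ∂c₂.piS := by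
  refine ENNReal.tsum_le_of_sum_range_le fun n => ?_
  induction n generalizing f with
  | zero => simp
  | succ n ih =>
    rw [Finset.sum_range_succ', add_comm]
    simp only [Function.iterate_succ_apply]
    refine le_trans ?_ (lintegral_embeddedOp_le c₁ c₂ hf)
    exact add_le_add le_rfl (ih (measurable_embeddedOp c₁ c₂ hf))

end Compound

/-! ### Decomposition of the first compound block -/

section Compound

variable {E₁ E₂ : Type*}

/-- The values of `g` along the trajectory of the compound chain. -/
abbrev pairValues (g : E₁ × E₂ → ℝ≥0∞) (ω : Path E₁ E₂) : ℕ → ℝ≥0∞ :=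
  fun t => g ((ω.1 t).1, (ω.2 t).1)

/-- The sum of `g` over the `j`-th block of the first chain. -/
def innerBlock (g : E₁ × E₂ → ℝ≥0∞) (j : ℕ) (ω : Path E₁ E₂) : ℝ≥0∞ :=
  blockTsum (coins ω.1) (pairValues g ω) j

/-- The event that the second chain regenerates at the `j`-th regeneration time of the first
chain. -/
def regenAt (ω : Path E₁ E₂) (j : ℕ) : Prop :=
  ∃ t : ℕ, regen (coins ω.1) j = t ∧ (ω.2 t).2 = true

theorem embeddedRegen_eq (ω : Path E₁ E₂) : embeddedRegen ω = firstTime (regenAt ω) := rfl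

open scoped Classical in
/-- The `q`-th power of the sum of `g` over the `j`-th block of the first chain if this block
is contained in the first block of the compound chain, and `0` otherwise. -/
def innerPow (g : E₁ × E₂ → ℝ≥0∞) (q j : ℕ) (ω : Path E₁ E₂) : ℝ≥0∞ :=
  if (j : ℕ∞) ≤ embeddedRegen ω then innerBlock g j ω ^ q else 0

theorem innerPow_zero (g : E₁ × E₂ → ℝ≥0∞) (q : ℕ) (ω : Path E₁ E₂) :
    innerPow g q 0 ω = innerBlock g 0 ω ^ q := by
  rw [innerPow, if_pos (by simp)]

/-- Only the n at which X first regenerates contributes. There block j + 1 becomes block j of the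
shifted pair, and j + 1 ≤ 𝒯 means that W does not regenerate at n and j ≤ 𝒯 for the shifted pair. If
X never regenerates, 𝒯 is infinite but the block is empty, whence `hq`. -/
theorem innerPow_succ (g : E₁ × E₂ → ℝ≥0∞) {q : ℕ} (hq : q ≠ 0) (j : ℕ) (ω : Path E₁ E₂) :
    innerPow g q (j + 1) ω = ∑' n, afterFirst n (innerPow g q j) ω := by
  rcases eq_or_ne (regen (coins ω.1) 0) ⊤ with htop | htop
  · have h0 : ∀ n, afterFirst n (innerPow g q j) ω = 0 := fun n => by
      refine Set.indicator_of_notMem (fun h => ?_) _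
      rw [firstRegenAt, Set.mem_ofPred_eq, htop] at h
      exact ENat.top_ne_natCast _ h
    rw [tsum_congr h0, tsum_zero, innerPow, innerBlock, blockTsum_succ_of_top htop, zero_pow hq,
      ite_self]
  · obtain ⟨n, hn⟩ := ENat.ne_top_iff_exists.1 htop
    have hn : regen (coins ω.1) 0 = n := hn.symm
    rw [tsum_eq_single n]
    · rw [afterFirst, Set.indicator_of_mem (show ω.1 ∈ firstRegenAt E₁ n from hn)]
      have h0 : regenAt ω 0 ↔ (ω.2 n).2 = true := by
        rw [regenAt, hn]
        simp
      set ω' : Path E₁ E₂ := (shiftPath (n + 1) ω.1, shiftPath (n + 1) ω.2)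
      have hsucc (i : ℕ) : regenAt ω (i + 1) ↔ regenAt ω' i := by
        have hr : regen (coins ω.1) (i + 1) = regen (coins ω'.1) i + ((n + 1 : ℕ) : ℕ∞) :=
          regen_of_first hn i
        constructor
        · rintro ⟨t, ht, h⟩
          rw [hr] at ht
          have hle : n + 1 ≤ t := by
            have h' : ((n + 1 : ℕ) : ℕ∞) ≤ t := ht ▸ le_add_self
            exact_mod_cast h'
          obtain ⟨u, rfl⟩ := Nat.exists_eq_add_of_le' hle
          refine ⟨u, ?_, h⟩
          rw [Nat.cast_add u] at ht
          exact WithTop.add_right_cancel (ENat.natCast_ne_top _) ht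
        · rintro ⟨t, ht, h⟩
          refine ⟨t + (n + 1), ?_, h⟩
          rw [hr, ht, Nat.cast_add t]
      have hle : ((j + 1 : ℕ) : ℕ∞) ≤ embeddedRegen ω ↔
          ¬ (ω.2 n).2 = true ∧ (j : ℕ∞) ≤ embeddedRegen ω' := by
        rw [embeddedRegen_eq, embeddedRegen_eq, le_firstTime_iff, le_firstTime_iff, ← h0]
        simp only [← hsucc]
        refine ⟨fun h => ⟨h 0 (Nat.succ_pos j), fun i hi => h (i + 1) (by omega)⟩, ?_⟩
        rintro ⟨h, h'⟩ i hi
        cases i with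
        | zero => exact h
        | succ i => exact h' i (by omega)
      have hb : innerBlock g (j + 1) ω = innerBlock g j ω' := blockTsum_succ_of_first hn _ j
      rw [innerPow, innerPow, hb]
      simp only [hle]
      by_cases h1 : (ω.2 n).2 = true <;> simp [h1]
    · intro m hm
      refine Set.indicator_of_notMem (fun h => hm ?_) _
      rw [firstRegenAt, Set.mem_ofPred_eq, hn, Nat.cast_inj] at h
      exact h.symm

/-- Induction on t: the index of the block of X grows only when X regenerates, and before the end of
the compound block W does not regenerate at such a time, so the index stays at most 𝒯. -/
theorem exists_mem_block_of_mem_compound (ω : Path E₁ E₂) {t : ℕ}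
    (ht : t ∈ block (compoundY ω) 0) :
    ∃ j : ℕ, t ∈ block (coins ω.1) j ∧ (j : ℕ∞) ≤ embeddedRegen ω := by
  rw [mem_block_zero_iff] at ht
  induction t with
  | zero => exact ⟨0, mem_block_zero_iff.2 (by simp), by simp⟩
  | succ t ih =>
    obtain ⟨j, hj, hjT⟩ := ih fun i hi => ht i (by omega)
    by_cases h : (ω.1 t).2 = true
    · refine ⟨j + 1, succ_mem_block_succ hj h, ?_⟩
      rw [embeddedRegen_eq, le_firstTime_iff] at hjT ⊢
      rintro i hi ⟨u, hu, hu'⟩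
      rcases Nat.lt_succ_iff_lt_or_eq.1 hi with hi | rfl
      · exact hjT i hi ⟨u, hu, hu'⟩
      · rw [regen_eq_of_mem_block hj h, Nat.cast_inj] at hu
        subst hu
        have := ht t (Nat.lt_succ_self t)
        rw [compoundY, h, hu'] at this
        simp at this
    · exact ⟨j, succ_mem_block hj (eq_false_of_ne_true h), hjT⟩

open scoped Classical in
theorem blockTsum_compound_le (g : E₁ × E₂ → ℝ≥0∞) (ω : Path E₁ E₂) :
    blockTsum (compoundY ω) (pairValues g ω) 0 ≤
      ∑' j : ℕ, if (j : ℕ∞) ≤ embeddedRegen ω then innerBlock g j ω else 0 := by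
  have h : ∀ t, (block (compoundY ω) 0).indicator (pairValues g ω) t ≤
      ∑' j : ℕ, if (j : ℕ∞) ≤ embeddedRegen ω
        then (block (coins ω.1) j).indicator (pairValues g ω) t else 0 := fun t => by
    by_cases ht : t ∈ block (compoundY ω) 0
    · obtain ⟨j, hj, hjT⟩ := exists_mem_block_of_mem_compound ω ht
      refine le_trans (le_of_eq ?_) (ENNReal.le_tsum j)
      rw [if_pos hjT, Set.indicator_of_mem ht, Set.indicator_of_mem hj]
    · rw [Set.indicator_of_notMem ht]
      exact zero_le
  refine (ENNReal.tsum_le_tsum h).trans (le_of_eq ?_)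
  rw [ENNReal.tsum_comm]
  refine tsum_congr fun j => ?_
  split_ifs
  · rfl
  · simp

open scoped Classical in
theorem tsum_ite_le_natCast (T : ℕ∞) (a : ℝ≥0∞) :
    ∑' j : ℕ, (if (j : ℕ∞) ≤ T then a else 0) = ((T + 1 : ℕ∞) : ℝ≥0∞) * a := by
  induction T using ENat.recTopCoe with
  | top =>
    simp only [le_top, if_true, top_add, ENat.toENNReal_top]
    rcases eq_or_ne a 0 with rfl | ha
    · simp
    · rw [ENNReal.tsum_const_eq_top_of_ne_zero ha, ENNReal.top_mul ha]
  | coe n =>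
    rw [tsum_eq_sum (s := Finset.range (n + 1)), Finset.sum_congr rfl (g := fun _ => a)]
    · simp
    · intro j hj
      rw [if_pos]
      exact_mod_cast Nat.lt_succ_iff.1 (Finset.mem_range.1 hj)
    · intro j hj
      rw [if_neg]
      rw [Nat.cast_le]
      simpa using hj

/-- The first compound block sum is at most `𝒯 + 1` times an `ℓ^q` norm of the sums over the
blocks of the first chain. -/
theorem blockTsum_compound_le_mul (g : E₁ × E₂ → ℝ≥0∞) {q : ℕ} (hq : q ≠ 0) (ω : Path E₁ E₂) :
    blockTsum (compoundY ω) (pairValues g ω) 0 ≤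
      ((embeddedRegen ω + 1 : ℕ∞) : ℝ≥0∞) * (∑' j, innerPow g q j ω) ^ (q⁻¹ : ℝ) := by
  classical
  rw [← tsum_ite_le_natCast]
  refine (blockTsum_compound_le g ω).trans (ENNReal.tsum_le_tsum fun j => ?_)
  split_ifs with h
  · have h1 : innerPow g q j ω = innerBlock g j ω ^ q := if_pos h
    have h2 := ENNReal.rpow_le_rpow (ENNReal.le_tsum (f := fun j => innerPow g q j ω) j)
      (inv_nonneg.2 (Nat.cast_nonneg q) : (0 : ℝ) ≤ (q : ℝ)⁻¹)
    rwa [h1, ENNReal.pow_rpow_inv_natCast hq] at h2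
  · exact le_rfl

variable [MeasurableSpace E₁] [MeasurableSpace E₂]

theorem measurable_embeddedRegen : Measurable (embeddedRegen (E₁ := E₁) (E₂ := E₂)) := by
  simp_rw [funext embeddedRegen_eq]
  refine measurable_firstTime fun j => ?_
  have : {ω : Path E₁ E₂ | regenAt ω j} =
      ⋃ t : ℕ, {ω : Path E₁ E₂ | regen (coins ω.1) j = t} ∩ {ω | (ω.2 t).2 = true} := by
    ext ω
    simp [regenAt]
  rw [this]
  refine MeasurableSet.iUnion fun t => MeasurableSet.inter ?_ ?_
  · exact ((measurable_regen j).comp (measurable_coins.comp measurable_fst))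
      (measurableSet_singleton _)
  · exact (measurable_snd.comp ((measurable_pi_apply t).comp measurable_snd))
      (measurableSet_singleton true)

theorem measurable_pairValues {g : E₁ × E₂ → ℝ≥0∞} (hg : Measurable g) :
    Measurable (pairValues g) :=
  measurable_pi_lambda _ fun t => hg.comp
    ((measurable_fst.comp ((measurable_pi_apply t).comp measurable_fst)).prodMk
      (measurable_fst.comp ((measurable_pi_apply t).comp measurable_snd)))

theorem measurable_innerBlock {g : E₁ × E₂ → ℝ≥0∞} (hg : Measurable g) (j : ℕ) :
    Measurable (innerBlock g j) :=
  measurable_blockTsum (measurable_coins.comp measurable_fst) (measurable_pairValues hg) j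

theorem measurable_innerPow {g : E₁ × E₂ → ℝ≥0∞} (hg : Measurable g) (q j : ℕ) :
    Measurable (innerPow g q j) := by
  classical
  refine Measurable.ite ?_ ((measurable_innerBlock hg j).pow_const q) measurable_const
  exact measurable_embeddedRegen (MeasurableSet.of_discrete (s := Set.Ici _))

variable (c₁ : AtomicChain E₁) (c₂ : AtomicChain E₂)

/-- Each further block of X inserts one application of the killed embedded operator, by
`innerPow_succ` and `pairMean_afterFirst`. -/
theorem pairMean_innerPow {g : E₁ × E₂ → ℝ≥0∞} (hg : Measurable g) {q : ℕ} (hq : q ≠ 0) (j : ℕ) :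
    pairMean c₁ c₂ (innerPow g q j) =
      (embeddedOp c₁ c₂)^[j] (pairMean c₁ c₂ (innerPow g q 0)) := by
  induction j with
  | zero => rfl
  | succ j ih =>
    rw [Function.iterate_succ_apply', ← ih]
    ext w
    have hm := measurable_innerPow hg q j
    simp_rw [embeddedOp, ← pairMean_afterFirst c₁ c₂ _ hm, funext (innerPow_succ g hq j), pairMean]
    rw [← lintegral_tsum fun n => (measurable_afterFirst n hm).lintegral_prod_left'.aemeasurable]
    refine lintegral_congr fun ω₂ => ?_
    exact lintegral_tsum fun n =>
      ((measurable_afterFirst n hm).comp measurable_prodMk_right).aemeasurable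

theorem tsum_lintegral_innerPow_le {g : E₁ × E₂ → ℝ≥0∞} (hg : Measurable g) {q : ℕ}
    (hq : q ≠ 0) :
    ∫⁻ ω, ∑' j, innerPow g q j ω ∂pairLaw c₁ c₂ c₁.ν c₂.ν ≤
      ∫⁻ w, pairMean c₁ c₂ (fun ω => innerBlock g 0 ω ^ q) w ∂c₂.piS := by
  rw [lintegral_tsum fun j => (measurable_innerPow hg q j).aemeasurable,
    ← funext (innerPow_zero g q)]
  simp_rw [lintegral_pairLaw_eq_pairMean c₁ c₂ (measurable_innerPow hg q _)]
  rw [tsum_congr fun j => congrArg (fun f => ∫⁻ w, f w ∂c₂.ν) (pairMean_innerPow c₁ c₂ hg hq j)]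
  exact tsum_lintegral_embeddedOp_iterate_le c₁ c₂
    (measurable_pairMean c₁ c₂ (measurable_innerPow hg q 0))

/-- Jensen's inequality for the weights w, in unnormalized form. -/
theorem tsum_mul_pow_le (w f : ℕ → ℝ≥0∞) (r : ℕ) :
    (∑' t, w t * f t) ^ (r + 1) ≤ (∑' t, w t) ^ r * ∑' t, w t * f t ^ (r + 1) := by
  have hp : (1 : ℝ) ≤ (r + 1 : ℕ) := by exact_mod_cast Nat.succ_pos r
  have hp0 : (0 : ℝ) < (r + 1 : ℕ) := by linarith
  have h : ∑' t, w t * f t ≤ (∑' t, w t) ^ (1 - ((r + 1 : ℕ) : ℝ)⁻¹) *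
      (∑' t, w t * f t ^ (r + 1)) ^ (((r + 1 : ℕ) : ℝ)⁻¹) := by
    rw [ENNReal.tsum_eq_iSup_sum]
    refine iSup_le fun s => (ENNReal.inner_le_weight_mul_Lp_of_nonneg s hp w f).trans ?_
    simp_rw [ENNReal.rpow_natCast]
    refine mul_le_mul' (ENNReal.rpow_le_rpow (ENNReal.sum_le_tsum s) ?_)
      (ENNReal.rpow_le_rpow (ENNReal.sum_le_tsum s) (by positivity))
    exact sub_nonneg.2 (inv_le_one_of_one_le₀ hp)
  refine (pow_le_pow_left' h (r + 1)).trans (le_of_eq ?_)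
  rw [mul_pow, ← ENNReal.rpow_natCast, ← ENNReal.rpow_natCast, ← ENNReal.rpow_mul,
    ← ENNReal.rpow_mul, inv_mul_cancel₀ hp0.ne', ENNReal.rpow_one, sub_mul,
    inv_mul_cancel₀ hp0.ne', one_mul]
  congr 1
  rw [← ENNReal.rpow_natCast]
  congr 1
  push_cast
  ring

/-- Jensen with weights a(X_t) gives V_0^{r+1} ≤ S^r ∑_t a(X_t) b(W_t)^{r+1}, the sum running over
the block of X. By independence the factor in W can be averaged for each fixed t, and π_{s₂}P₂^t ≤
π_{s₂} makes the bound free of t; the remaining weights add up to S^{r+1}. -/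
theorem lintegral_piS_pairMean_le {a : E₁ → ℝ≥0∞} {b : E₂ → ℝ≥0∞} (ha : Measurable a)
    (hb : Measurable b) (r : ℕ) :
    ∫⁻ w, pairMean c₁ c₂ (fun ω => innerBlock (fun z => a z.1 * b z.2) 0 ω ^ (r + 1)) w ∂c₂.piS ≤
      (∫⁻ w, b w ^ (r + 1) ∂c₂.piS) * ∫⁻ x, c₁.blockMoment a (r + 1) x ∂c₁.ν := by
  have hg : Measurable fun z : E₁ × E₂ => a z.1 * b z.2 :=
    (ha.comp measurable_fst).mul (hb.comp measurable_snd)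
  have hbr : Measurable fun w => b w ^ (r + 1) := hb.pow_const _
  let S : (ℕ → E₁ × Bool) → ℝ≥0∞ := fun ω => blockTsum (coins ω) (values a ω) 0
  have hS : Measurable S := measurable_blockTsum measurable_coins (measurable_values ha) 0
  let u : ℕ → (ℕ → E₁ × Bool) → ℝ≥0∞ := fun t ω => (block (coins ω) 0).indicator (values a ω) t
  have hu (t : ℕ) : Measurable (u t) :=
    ((measurable_pi_apply t).comp (measurable_values ha)).indicator
      (measurable_coins (measurableSet_mem_block 0 t))
  have hSu (ω) : S ω = ∑' t, u t ω := rfl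
  have hSm (t : ℕ) : Measurable fun ω => S ω ^ r * u t ω := (hS.pow_const r).mul (hu t)
  have hv (t : ℕ) : Measurable fun ω : ℕ → E₂ × Bool => b (ω t).1 ^ (r + 1) :=
    hbr.comp (measurable_fst.comp (measurable_pi_apply t))
  have hpoint (ω₁ : ℕ → E₁ × Bool) (ω₂ : ℕ → E₂ × Bool) :
      innerBlock (fun z => a z.1 * b z.2) 0 (ω₁, ω₂) ^ (r + 1) ≤
        ∑' t, S ω₁ ^ r * u t ω₁ * b (ω₂ t).1 ^ (r + 1) := by
    simp_rw [mul_assoc, ENNReal.tsum_mul_left]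
    refine le_trans (le_of_eq ?_) (tsum_mul_pow_le (fun t => u t ω₁) (fun t => b (ω₂ t).1) r)
    congr 1
    refine tsum_congr fun t => ?_
    simp only [u]
    by_cases h : t ∈ block (coins ω₁) 0
    · rw [Set.indicator_of_mem h, Set.indicator_of_mem h]
    · rw [Set.indicator_of_notMem h, Set.indicator_of_notMem h, zero_mul]
  have hmean (w : E₂) :
      pairMean c₁ c₂ (fun ω => innerBlock (fun z => a z.1 * b z.2) 0 ω ^ (r + 1)) w ≤
        ∑' t, (∫⁻ ω, S ω ^ r * u t ω ∂c₁.splitLaw c₁.ν) *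
          ∫⁻ v, b v ^ (r + 1) ∂(c₂.P ^ t) w := by
    rw [pairMean]
    calc _ ≤ ∫⁻ ω₂, ∫⁻ ω₁, ∑' t, S ω₁ ^ r * u t ω₁ * b (ω₂ t).1 ^ (r + 1) ∂c₁.splitLaw c₁.ν
            ∂c₂.path w := lintegral_mono fun ω₂ => lintegral_mono fun ω₁ => hpoint ω₁ ω₂
      _ = ∫⁻ ω₂, ∑' t, (∫⁻ ω, S ω ^ r * u t ω ∂c₁.splitLaw c₁.ν) * b (ω₂ t).1 ^ (r + 1)
            ∂c₂.path w := by
          refine lintegral_congr fun ω₂ => ?_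
          rw [lintegral_tsum fun t => ((hSm t).mul_const _).aemeasurable]
          exact tsum_congr fun t => lintegral_mul_const _ (hSm t)
      _ = _ := by
          rw [lintegral_tsum fun t => ((hv t).const_mul _).aemeasurable]
          refine tsum_congr fun t => ?_
          rw [lintegral_const_mul _ (hv t), c₂.lintegral_path_apply w t hbr]
  calc _ ≤ ∫⁻ w, ∑' t, (∫⁻ ω, S ω ^ r * u t ω ∂c₁.splitLaw c₁.ν) *
          ∫⁻ v, b v ^ (r + 1) ∂(c₂.P ^ t) w ∂c₂.piS := lintegral_mono hmean
    _ = ∑' t, (∫⁻ ω, S ω ^ r * u t ω ∂c₁.splitLaw c₁.ν) *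
          ∫⁻ w, ∫⁻ v, b v ^ (r + 1) ∂(c₂.P ^ t) w ∂c₂.piS := by
        rw [lintegral_tsum fun t => (hbr.lintegral_kernel.const_mul _).aemeasurable]
        exact tsum_congr fun t => lintegral_const_mul _ hbr.lintegral_kernel
    _ ≤ ∑' t, (∫⁻ ω, S ω ^ r * u t ω ∂c₁.splitLaw c₁.ν) * ∫⁻ w, b w ^ (r + 1) ∂c₂.piS := by
        refine ENNReal.tsum_le_tsum fun t => mul_le_mul_right ?_ _
        exact c₂.lintegral_piS_P_pow_le t hbr
    _ = (∫⁻ w, b w ^ (r + 1) ∂c₂.piS) * ∫⁻ x, c₁.blockMoment a (r + 1) x ∂c₁.ν := by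
        rw [ENNReal.tsum_mul_right, mul_comm,
          ← lintegral_tsum fun t => (hSm t).aemeasurable]
        simp_rw [ENNReal.tsum_mul_left, ← hSu, ← pow_succ]
        rw [c₁.lintegral_splitLaw _ (hS.pow_const _)]
        rfl

end Compound

/-! ### Reduction to the first block -/

section Compound

variable {E₁ E₂ : Type*}

theorem enorm_blockSum_le (g : E₁ × E₂ → ℝ) (k : ℕ) (ω : Path E₁ E₂) :
    ‖blockSum g k ω‖ₑ ≤ blockTsum (compoundY ω) (pairValues (fun z => ‖g z‖ₑ) ω) k := by
  refine (enorm_tsum_le_tsum_enorm).trans (le_of_eq (tsum_congr fun t => ?_))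
  exact enorm_indicator_eq_indicator_enorm _ _

/-- The pair of trajectories that starts at `z₁`, `z₂` and then follows `ω`. -/
def pairCons (z₁ : E₁ × Bool) (z₂ : E₂ × Bool) (ω : Path E₁ E₂) : Path E₁ E₂ :=
  (pathCons z₁ ω.1, pathCons z₂ ω.2)

open scoped Classical in
/-- The `q`-th power of the sum of `g` over the `(k + 1)`-st block of the compound chain if this
block starts before or at time `n`, and `0` otherwise. -/
def truncatedBlockPow (g : E₁ × E₂ → ℝ≥0∞) (q k n : ℕ) (ω : Path E₁ E₂) : ℝ≥0∞ :=
  if regen (compoundY ω) k < n then blockTsum (compoundY ω) (pairValues g ω) (k + 1) ^ q else 0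

theorem truncatedBlockPow_pairCons (g : E₁ × E₂ → ℝ≥0∞) (q k n : ℕ) (z₁ : E₁ × Bool)
    (z₂ : E₂ × Bool) (h : (z₁.2 && z₂.2) = false) (ω : Path E₁ E₂) :
    truncatedBlockPow g q k (n + 1) (pairCons z₁ z₂ ω) = truncatedBlockPow g q k n ω := by
  have h0 : compoundY (pairCons z₁ z₂ ω) 0 = false := h
  have hr : regen (compoundY (pairCons z₁ z₂ ω)) k < ((n + 1 : ℕ) : ℕ∞) ↔
      regen (compoundY ω) k < n := by
    rw [regen_of_first_false h0, Nat.cast_add n,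
      ENat.add_lt_add_iff_right (ENat.natCast_ne_top _)]
    rfl
  rw [truncatedBlockPow, truncatedBlockPow, blockTsum_succ_of_first_false h0]
  simp only [hr]
  rfl

theorem truncatedBlockPow_zero_pairCons_le (g : E₁ × E₂ → ℝ≥0∞) (q n : ℕ) (z₁ : E₁ × Bool)
    (z₂ : E₂ × Bool) (h : (z₁.2 && z₂.2) = true) (ω : Path E₁ E₂) :
    truncatedBlockPow g q 0 n (pairCons z₁ z₂ ω) ≤
      blockTsum (compoundY ω) (pairValues g ω) 0 ^ q := by
  have h0 : regen (compoundY (pairCons z₁ z₂ ω)) 0 = (0 : ℕ) := by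
    rw [regen_zero_eq, firstTime_eq_iff]
    exact ⟨h, by simp⟩
  rw [truncatedBlockPow, blockTsum_succ_of_first h0]
  split_ifs
  · exact le_rfl
  · exact zero_le

theorem truncatedBlockPow_succ_pairCons (g : E₁ × E₂ → ℝ≥0∞) (q k n : ℕ) (z₁ : E₁ × Bool)
    (z₂ : E₂ × Bool) (h : (z₁.2 && z₂.2) = true) (ω : Path E₁ E₂) :
    truncatedBlockPow g q (k + 1) (n + 1) (pairCons z₁ z₂ ω) = truncatedBlockPow g q k n ω := by
  have h0 : regen (compoundY (pairCons z₁ z₂ ω)) 0 = (0 : ℕ) := by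
    rw [regen_zero_eq, firstTime_eq_iff]
    exact ⟨h, by simp⟩
  have hr : regen (compoundY (pairCons z₁ z₂ ω)) (k + 1) < ((n + 1 : ℕ) : ℕ∞) ↔
      regen (compoundY ω) k < n := by
    rw [regen_of_first h0, Nat.cast_add n, zero_add,
      ENat.add_lt_add_iff_right (ENat.natCast_ne_top _)]
    rfl
  rw [truncatedBlockPow, truncatedBlockPow, blockTsum_succ_of_first h0]
  simp only [hr]
  rfl

variable [MeasurableSpace E₁] [MeasurableSpace E₂]

theorem AtomicChain.lintegral_splitChain_step' (c : AtomicChain E₁) (z : E₁ × Bool)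
    {F : (ℕ → E₁ × Bool) → ℝ≥0∞} (hF : Measurable F) :
    ∫⁻ ω, F ω ∂chainKernel c.splitKernel z =
      ∫⁻ ω, F (pathCons z ω) ∂c.splitLaw (c.move z) := by
  have hc : Measurable fun ω => F (pathCons z ω) := hF.comp (measurable_pathCons_right z)
  rw [c.lintegral_splitChain_step z hF, c.lintegral_splitLaw _ hc]

variable (c₁ : AtomicChain E₁) (c₂ : AtomicChain E₂)

theorem measurable_pairCons (z₁ : E₁ × Bool) (z₂ : E₂ × Bool) :
    Measurable (pairCons z₁ z₂) :=
  ((measurable_pathCons_right z₁).comp measurable_fst).prodMk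
    ((measurable_pathCons_right z₂).comp measurable_snd)

/-- A bound that holds after one step from every pair of split states holds for every product
initial law. After the step the pair again has a product initial law, so the criterion suits
induction. -/
theorem lintegral_pairLaw_le_of_step (l₁ : Measure E₁) (l₂ : Measure E₂) [IsProbabilityMeasure l₁]
    [IsProbabilityMeasure l₂] {Φ : Path E₁ E₂ → ℝ≥0∞} (hΦ : Measurable Φ) {M : ℝ≥0∞}
    (h : ∀ z₁ z₂, ∫⁻ ω, Φ (pairCons z₁ z₂ ω) ∂pairLaw c₁ c₂ (c₁.move z₁) (c₂.move z₂) ≤ M) :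
    ∫⁻ ω, Φ ω ∂pairLaw c₁ c₂ l₁ l₂ ≤ M := by
  have hright (ω₁ : ℕ → E₁ × Bool) : Measurable fun ω₂ => Φ (ω₁, ω₂) :=
    hΦ.comp measurable_prodMk_left
  have hz (z₁ : E₁ × Bool) (z₂ : E₂ × Bool) :
      ∫⁻ ω₁, ∫⁻ ω₂, Φ (ω₁, ω₂) ∂chainKernel c₂.splitKernel z₂ ∂chainKernel c₁.splitKernel z₁
        ≤ M := by
    refine le_trans (le_of_eq ?_) (h z₁ z₂)
    have hc : Measurable fun ω => Φ (pairCons z₁ z₂ ω) := hΦ.comp (measurable_pairCons z₁ z₂)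
    rw [lintegral_pairLaw c₁ c₂ _ _ hc,
      c₁.lintegral_splitChain_step' z₁ hΦ.lintegral_prod_right']
    exact lintegral_congr fun ω₁ => c₂.lintegral_splitChain_step' z₂ (hright _)
  have hm : Measurable fun p : (ℕ → E₁ × Bool) × (E₂ × Bool) =>
      ∫⁻ ω₂, Φ (p.1, ω₂) ∂chainKernel c₂.splitKernel p.2 :=
    Measurable.lintegral_kernel_prod_right' (κ := (chainKernel c₂.splitKernel).comap
      (fun p : (ℕ → E₁ × Bool) × (E₂ × Bool) => p.2) measurable_snd)
      (f := fun q => Φ (q.1.1, q.2))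
      (hΦ.comp ((measurable_fst.comp measurable_fst).prodMk measurable_snd))
  rw [lintegral_pairLaw c₁ c₂ _ _ hΦ]
  calc ∫⁻ ω₁, ∫⁻ ω₂, Φ (ω₁, ω₂) ∂c₂.splitLaw l₂ ∂c₁.splitLaw l₁
      = ∫⁻ ω₁, ∫⁻ z₂, ∫⁻ ω₂, Φ (ω₁, ω₂) ∂chainKernel c₂.splitKernel z₂ ∂(l₂ ⊗ₘ c₂.coin)
          ∂c₁.splitLaw l₁ := lintegral_congr fun ω₁ => lintegral_chainLaw _ _ (hright ω₁)
    _ = ∫⁻ z₁, ∫⁻ ω₁, ∫⁻ z₂, ∫⁻ ω₂, Φ (ω₁, ω₂) ∂chainKernel c₂.splitKernel z₂ ∂(l₂ ⊗ₘ c₂.coin)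
          ∂chainKernel c₁.splitKernel z₁ ∂(l₁ ⊗ₘ c₁.coin) :=
        lintegral_chainLaw _ _ hm.lintegral_prod_right'
    -- Fubini brings both starting states outermost, where the hypothesis applies pointwise.
    _ = ∫⁻ z₁, ∫⁻ z₂, ∫⁻ ω₁, ∫⁻ ω₂, Φ (ω₁, ω₂) ∂chainKernel c₂.splitKernel z₂
          ∂chainKernel c₁.splitKernel z₁ ∂(l₂ ⊗ₘ c₂.coin) ∂(l₁ ⊗ₘ c₁.coin) :=
        lintegral_congr fun z₁ => lintegral_lintegral_swap
          (f := fun ω₁ z₂ => ∫⁻ ω₂, Φ (ω₁, ω₂) ∂chainKernel c₂.splitKernel z₂) hm.aemeasurable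
    _ ≤ ∫⁻ _, ∫⁻ _, M ∂(l₂ ⊗ₘ c₂.coin) ∂(l₁ ⊗ₘ c₁.coin) :=
        lintegral_mono fun z₁ => lintegral_mono fun z₂ => hz z₁ z₂
    _ = M := by simp

theorem measurable_compoundY : Measurable (compoundY (E₁ := E₁) (E₂ := E₂)) := by
  refine measurable_pi_lambda _ fun t => ?_
  have h : Measurable fun p : Bool × Bool => p.1 && p.2 := measurable_of_countable _
  exact h.comp ((measurable_snd.comp ((measurable_pi_apply t).comp measurable_fst)).prodMk
    (measurable_snd.comp ((measurable_pi_apply t).comp measurable_snd)))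

theorem measurable_compound_blockTsum {g : E₁ × E₂ → ℝ≥0∞} (hg : Measurable g) (k : ℕ) :
    Measurable fun ω => blockTsum (compoundY ω) (pairValues g ω) k :=
  measurable_blockTsum measurable_compoundY (measurable_pairValues hg) k

theorem measurable_truncatedBlockPow {g : E₁ × E₂ → ℝ≥0∞} (hg : Measurable g) (q k n : ℕ) :
    Measurable (truncatedBlockPow g q k n) := by
  classical
  refine Measurable.ite ?_ ((measurable_compound_blockTsum hg (k + 1)).pow_const q)
    measurable_const
  exact ((measurable_regen k).comp measurable_compoundY)
    (MeasurableSet.of_discrete (s := Set.Iio _))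

/-- Each step lowers the horizon n by one. Without a joint regeneration k is unchanged; a joint
regeneration restarts both chains from ν₁ and ν₂ and lowers k, and at k = 0 the block in question
becomes the first block of the restarted pair. -/
theorem lintegral_truncatedBlockPow_le {g : E₁ × E₂ → ℝ≥0∞} (hg : Measurable g) (q k n : ℕ)
    (l₁ : Measure E₁) (l₂ : Measure E₂) [IsProbabilityMeasure l₁] [IsProbabilityMeasure l₂] :
    ∫⁻ ω, truncatedBlockPow g q k n ω ∂pairLaw c₁ c₂ l₁ l₂ ≤
      ∫⁻ ω, blockTsum (compoundY ω) (pairValues g ω) 0 ^ q ∂pairLaw c₁ c₂ c₁.ν c₂.ν := by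
  induction n generalizing k l₁ l₂ with
  | zero => simp [truncatedBlockPow]
  | succ n ih =>
    refine lintegral_pairLaw_le_of_step c₁ c₂ l₁ l₂
      (measurable_truncatedBlockPow hg q k (n + 1)) fun z₁ z₂ => ?_
    cases h : (z₁.2 && z₂.2) with
    | false =>
      simp_rw [truncatedBlockPow_pairCons g q k n z₁ z₂ h]
      exact ih k _ _
    | true =>
      have h1 : c₁.move z₁ = c₁.ν := if_pos (Bool.and_eq_true_iff.1 h).1
      have h2 : c₂.move z₂ = c₂.ν := if_pos (Bool.and_eq_true_iff.1 h).2
      rw [h1, h2]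
      cases k with
      | zero => exact lintegral_mono fun ω => truncatedBlockPow_zero_pairCons_le g q _ z₁ z₂ h ω
      | succ k =>
        simp_rw [truncatedBlockPow_succ_pairCons g q k n z₁ z₂ h]
        exact ih k _ _

/-- The moments of the block sums of the compound chain, whatever its initial distribution, are
bounded by those of the first block sum of the chain that starts with a regeneration. -/
theorem lintegral_blockTsum_pow_le {g : E₁ × E₂ → ℝ≥0∞} (hg : Measurable g) {q : ℕ} (hq : q ≠ 0)
    (k : ℕ) (l₁ : Measure E₁) (l₂ : Measure E₂) [IsProbabilityMeasure l₁]
    [IsProbabilityMeasure l₂] :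
    ∫⁻ ω, blockTsum (compoundY ω) (pairValues g ω) (k + 1) ^ q ∂pairLaw c₁ c₂ l₁ l₂ ≤
      ∫⁻ ω, blockTsum (compoundY ω) (pairValues g ω) 0 ^ q ∂pairLaw c₁ c₂ c₁.ν c₂.ν := by
  have ht := lintegral_tendsto_of_tendsto_of_monotone (μ := pairLaw c₁ c₂ l₁ l₂)
    (F := fun ω => blockTsum (compoundY ω) (pairValues g ω) (k + 1) ^ q)
    (fun n => (measurable_truncatedBlockPow hg q k n).aemeasurable)
    (ae_of_all _ fun ω n m hnm => by
      simp only [truncatedBlockPow]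
      split_ifs with h1 h2
      · exact le_rfl
      · exact absurd (h1.trans_le (Nat.cast_le.2 hnm)) h2
      · exact zero_le
      · exact le_rfl)
    -- The truncated values are eventually constant: past τ_k the truncation is inactive, and if τ_k
    -- = ∞ the block is empty, so its sum to the power q ≠ 0 is 0.
    (ae_of_all _ fun ω => by
      refine tendsto_const_nhds.congr' ?_
      rcases eq_or_ne (regen (compoundY ω) k) ⊤ with htop | htop
      · refine Eventually.of_forall fun n => ?_
        have : block (compoundY ω) (k + 1) = ∅ := by
          ext t
          simp [block, htop]
        simp [truncatedBlockPow, blockTsum, this, zero_pow hq, htop]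
      · obtain ⟨N, hN⟩ := ENat.ne_top_iff_exists.1 htop
        filter_upwards [eventually_gt_atTop N] with n hn
        rw [truncatedBlockPow, ← hN, if_pos (Nat.cast_lt.2 hn)])
  exact le_of_tendsto' ht fun n => lintegral_truncatedBlockPow_le c₁ c₂ hg q k n l₁ l₂

/-! ### The moment bound for the compound chain -/

theorem lintegral_first_blockTsum_pow_le {a : E₁ → ℝ≥0∞} {b : E₂ → ℝ≥0∞} (ha : Measurable a)
    (hb : Measurable b) {m k : ℕ} (hm : 1 ≤ m) (hk : 1 ≤ k) :
    ∫⁻ ω, blockTsum (compoundY ω) (pairValues (fun z => a z.1 * b z.2) ω) 0 ^ (2 * m)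
        ∂pairLaw c₁ c₂ c₁.ν c₂.ν ≤
      (∫⁻ ω, ((embeddedRegen ω + 1 : ℕ∞) : ℝ≥0∞) ^ (2 * m * (k + 1) / k : ℝ)
        ∂pairLaw c₁ c₂ c₁.ν c₂.ν) ^ (k / (k + 1) : ℝ) *
      ((∫⁻ w, b w ^ (2 * m * (k + 1)) ∂c₂.piS) *
        ∫⁻ x, c₁.blockMoment a (2 * m * (k + 1)) x ∂c₁.ν) ^ (1 / (k + 1) : ℝ) := by
  set q : ℕ := 2 * m * (k + 1) with hqdef
  have hq : q ≠ 0 := by positivity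
  obtain ⟨r, hr⟩ := Nat.exists_eq_succ_of_ne_zero hq
  have hk0 : (0 : ℝ) < k := by exact_mod_cast hk
  have hm0 : (0 : ℝ) < m := by exact_mod_cast hm
  have hg : Measurable fun z : E₁ × E₂ => a z.1 * b z.2 :=
    (ha.comp measurable_fst).mul (hb.comp measurable_snd)
  set g : E₁ × E₂ → ℝ≥0∞ := fun z => a z.1 * b z.2 with hgdef
  let T : Path E₁ E₂ → ℝ≥0∞ := fun ω => ((embeddedRegen ω + 1 : ℕ∞) : ℝ≥0∞)
  let Z : Path E₁ E₂ → ℝ≥0∞ := fun ω => ∑' j, innerPow g q j ω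
  have hT : Measurable T :=
    (measurable_of_countable fun n : ℕ∞ => ((n + 1 : ℕ∞) : ℝ≥0∞)).comp measurable_embeddedRegen
  have hZ : Measurable Z := Measurable.tsum fun j => measurable_innerPow hg q j
  -- The exponent k + 1 matches q = 2m(k+1): the 2m-th power of (∑ V_j^q)^{1/q} is (∑
  -- V_j^q)^{1/(k+1)}, so Hölder leaves the plain mean of the sum.
  have hconj : Real.HolderConjugate (((k : ℝ) + 1) / k) (k + 1) := by
    rw [Real.holderConjugate_iff]
    refine ⟨by rw [lt_div_iff₀ hk0]; linarith, ?_⟩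
    field_simp
  calc ∫⁻ ω, blockTsum (compoundY ω) (pairValues g ω) 0 ^ (2 * m) ∂pairLaw c₁ c₂ c₁.ν c₂.ν
      ≤ ∫⁻ ω, ((fun ω => T ω ^ (2 * m : ℝ)) * fun ω => Z ω ^ (1 / (k + 1) : ℝ)) ω
          ∂pairLaw c₁ c₂ c₁.ν c₂.ν := by
        refine lintegral_mono fun ω => ?_
        refine (pow_le_pow_left' (blockTsum_compound_le_mul g hq ω) (2 * m)).trans (le_of_eq ?_)
        rw [mul_pow, Pi.mul_apply, ← ENNReal.rpow_natCast, ← ENNReal.rpow_natCast,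
          ← ENNReal.rpow_mul]
        congr 2
        · push_cast; ring
        · rw [hqdef]
          push_cast
          field_simp
    _ ≤ (∫⁻ ω, (T ω ^ (2 * m : ℝ)) ^ (((k : ℝ) + 1) / k) ∂pairLaw c₁ c₂ c₁.ν c₂.ν) ^
            (1 / (((k : ℝ) + 1) / k)) *
          (∫⁻ ω, (Z ω ^ (1 / (k + 1) : ℝ)) ^ ((k : ℝ) + 1) ∂pairLaw c₁ c₂ c₁.ν c₂.ν) ^
            (1 / ((k : ℝ) + 1)) :=
        ENNReal.lintegral_mul_le_Lp_mul_Lq _ hconj (hT.pow_const _).aemeasurable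
          (hZ.pow_const _).aemeasurable
    _ = (∫⁻ ω, T ω ^ (2 * m * (k + 1) / k : ℝ) ∂pairLaw c₁ c₂ c₁.ν c₂.ν) ^ (k / (k + 1) : ℝ) *
          (∫⁻ ω, Z ω ∂pairLaw c₁ c₂ c₁.ν c₂.ν) ^ (1 / (k + 1) : ℝ) := by
        simp_rw [← ENNReal.rpow_mul, one_div_div, mul_div_assoc]
        rw [one_div_mul_cancel (by positivity)]
        simp_rw [ENNReal.rpow_one]
    _ ≤ _ := by
        gcongr
        refine (tsum_lintegral_innerPow_le c₁ c₂ hg hq).trans ?_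
        rw [hr]
        exact lintegral_piS_pairMean_le c₁ c₂ ha hb r

end Compound

/-! ### Sets that shrink to a point of continuity of the density -/

theorem exists_piS_le_mul {E : Set ℝ} (hE : MeasurableSet E) (c : AtomicChain E) (x : E)
    (hdens : ∃ p : E → ℝ≥0, Measurable p ∧
      c.piS = ((volume : Measure ℝ).comap Subtype.val).withDensity (fun y => (p y : ℝ≥0∞)) ∧
      ContinuousAt p x ∧ 0 < p x)
    {N : Set E} {C : ℝ≥0} (hC : c.piS N ≤ C) {R : ℝ} (hR : 0 < R) :
    ∃ D : ℝ≥0, ∀ (B : Set E) (h : ℝ), MeasurableSet B → 0 < h → B ⊆ N →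
      (∀ y ∈ B, |(y : ℝ) - x| ≤ h * R) → c.piS B ≤ D * ENNReal.ofReal h := by
  obtain ⟨p, -, hp, hcont, -⟩ := hdens
  obtain ⟨δ, hδ, hpδ⟩ : ∃ δ > 0, ∀ y : E, |(y : ℝ) - x| < δ → p y ≤ p x + 1 := by
    have h1 : ∀ᶠ y in 𝓝 x, p y < p x + 1 := hcont.eventually_lt_const (lt_add_one _)
    obtain ⟨δ, hδ, h2⟩ := Metric.eventually_nhds_iff.1 h1
    exact ⟨δ, hδ, fun y hy => (h2 (by rwa [Subtype.dist_eq, Real.dist_eq])).le⟩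
  -- The first summand serves h R < δ, where the density is at most p(x) + 1 on B and B has length
  -- at most 2Rh. The second serves h R ≥ δ, where the crude bound C is at most C (R/δ) h.
  refine ⟨(p x + 1) * (2 * R).toNNReal + C * (R / δ).toNNReal, fun B h hB hh hBN hBh => ?_⟩
  push_cast
  rw [add_mul]
  rcases lt_or_ge (h * R) δ with hlt | hge
  · refine le_trans ?_ le_self_add
    calc c.piS B = ∫⁻ y in B, (p y : ℝ≥0∞) ∂((volume : Measure ℝ).comap Subtype.val) := by
          rw [hp, withDensity_apply _ hB]
      _ ≤ ∫⁻ _ in B, ((p x + 1 : ℝ≥0) : ℝ≥0∞) ∂((volume : Measure ℝ).comap Subtype.val) :=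
          setLIntegral_mono' hB fun y hy =>
            ENNReal.coe_le_coe.2 (hpδ y ((hBh y hy).trans_lt hlt))
      _ = (p x + 1) * volume (Subtype.val '' B : Set ℝ) := by
          rw [setLIntegral_const, comap_subtype_coe_apply hE]
          push_cast
          rfl
      _ ≤ (p x + 1) * volume (Metric.closedBall (x : ℝ) (h * R)) := by
          gcongr
          rintro _ ⟨y, hy, rfl⟩
          rw [Metric.mem_closedBall, Real.dist_eq]
          exact hBh y hy
      _ = (p x + 1) * ENNReal.ofReal (2 * R) * ENNReal.ofReal h := by
          rw [Real.volume_closedBall, mul_assoc, ← ENNReal.ofReal_mul (by positivity)]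
          congr 2
          ring
  · refine le_trans ?_ le_add_self
    calc c.piS B ≤ C := (measure_mono hBN).trans hC
      _ ≤ C * ENNReal.ofReal (R / δ * h) := by
          refine le_mul_of_one_le_right' ?_
          rw [ENNReal.one_le_ofReal, div_mul_eq_mul_div, one_le_div hδ, mul_comm]
          exact hge
      _ = C * ENNReal.ofReal (R / δ) * ENNReal.ofReal h := by
          rw [ENNReal.ofReal_mul (by positivity), mul_assoc]

theorem scaled_eq_zero_of_notMem {K : ℝ → ℝ} {x h y : ℝ} (hy : y ∉ nbhd K x h) :
    scaled K x h y = 0 := by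
  by_contra h'
  exact hy h'

theorem add_div_mem_nbhd_one {K : ℝ → ℝ} {x h y : ℝ} (hy : y ∈ nbhd K x h) :
    x + (y - x) / h ∈ nbhd K x 1 := by
  have h1 : K ((y - x) / h) ≠ 0 := fun h0 => hy (by rw [scaled, h0, mul_zero])
  simpa [nbhd, scaled] using h1

theorem measurable_scaled {K : ℝ → ℝ} (hK : Measurable K) (x h : ℝ) :
    Measurable (scaled K x h) := by
  unfold scaled
  fun_prop

theorem enorm_scaled_le_indicator {K : ℝ → ℝ} {M : ℝ} (hK0 : ∀ u, 0 ≤ K u) (hKM : ∀ u, K u ≤ M)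
    {E : Set ℝ} (x : ℝ) {h : ℝ} (hh : 0 < h) (y : E) :
    ‖scaled K x h y‖ₑ ≤
      {y : E | (y : ℝ) ∈ nbhd K x h}.indicator (fun _ => ENNReal.ofReal (h⁻¹ * M)) y := by
  by_cases hy : (y : ℝ) ∈ nbhd K x h
  · rw [Set.indicator_of_mem (show y ∈ {y : E | (y : ℝ) ∈ nbhd K x h} from hy)]
    have h0 : 0 ≤ scaled K x h y := mul_nonneg (inv_nonneg.2 hh.le) (hK0 _)
    rw [Real.enorm_of_nonneg h0]
    exact ENNReal.ofReal_le_ofReal (mul_le_mul_of_nonneg_left (hKM _) (inv_nonneg.2 hh.le))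
  · rw [scaled_eq_zero_of_notMem hy, enorm_zero]
    exact zero_le

end NullRec

end

/-! ### The theorem: constants and powers of the bandwidth -/

theorem theorem3p3
    -- the chain `X`, with state space `E₁ ⊆ ℝ`: irreducible, Harris recurrent, with an atom
    (E₁ : Set ℝ) (hE₁ : MeasurableSet E₁) (X : NullRec.AtomicChain E₁) (φ₁ : Measure E₁)
    (hX : X.IsIrred φ₁) (hHarris : NullRec.IsHarris φ₁ X.P)
    -- the point `x`, the set `N = 𝒩_x` (bounded and small) and the bound `M` for the kernel
    (x : E₁) (N : Set ℝ) (M : ℝ)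
    (hNbdd : Bornology.IsBounded N)
    (hNsmall : NullRec.IsSmallSet φ₁ X.P (Subtype.val ⁻¹' N))
    -- the invariant measure has a density, continuous and positive at `x`
    (hdens : ∃ p : E₁ → ℝ≥0, Measurable p ∧
      X.piS = ((volume : Measure ℝ).comap Subtype.val).withDensity (fun y => (p y : ℝ≥0∞)) ∧
      ContinuousAt p x ∧ 0 < p x) :
    -- the sequence `d'` depends on the kernel only through `𝒩_x` and the bound for `K`,
    -- and does not depend on `h`, `g_W` and the chain `W`
    ∃ d' : ℕ → ℝ≥0,
      ∀ K : ℝ → ℝ, Measurable K → (∀ u, 0 ≤ K u) → (∀ u, K u ≤ M) →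
        NullRec.nbhd K x 1 = N →
      ∀ E₂ : Set ℝ, MeasurableSet E₂ → ∀ (W : NullRec.AtomicChain E₂) (φ₂ : Measure E₂),
        W.IsIrred φ₂ → NullRec.IsErgodic W.P →
      ∀ gW : E₂ → ℝ, Measurable gW →
      ∀ h : ℝ, 0 < h → h ≤ 1 → (∀ y : E₁, (y : ℝ) ∈ NullRec.nbhd K x h → (y : ℝ) ∈ N) →
      ∀ k m : ℕ, 1 ≤ k → 1 ≤ m →
      -- `U` is any block sum `U_j` with `j ≥ 1`, whatever the initial distributions
      ∀ (l₁ : Measure E₁) (l₂ : Measure E₂), IsProbabilityMeasure l₁ → IsProbabilityMeasure l₂ →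
      ∀ j : ℕ, 1 ≤ j →
        ∫⁻ ω, ‖NullRec.blockSum
            (fun z : E₁ × E₂ => NullRec.scaled K x h z.1 * gW z.2) j ω‖ₑ ^ (2 * m)
            ∂(NullRec.pairLaw X W l₁ l₂)
          ≤ NullRec.momentConst X W gW (d' (2 * m * (k + 1))) m k *
            ENNReal.ofReal (h ^ (-(2 * m : ℝ) + 1 / (k + 1))) := by
  obtain ⟨C, hC⟩ := X.exists_G_le_of_isSmallSet hX hNsmall
  have hNm : MeasurableSet (Subtype.val ⁻¹' N : Set E₁) := hNsmall.1
  obtain ⟨R, hR0, hNR⟩ : ∃ R > 0, N ⊆ Metric.closedBall (x : ℝ) R := by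
    obtain ⟨R, hR⟩ := hNbdd.subset_closedBall (x : ℝ)
    exact ⟨max R 1, by positivity, hR.trans (Metric.closedBall_subset_closedBall (le_max_left _ _))⟩
  obtain ⟨D, hD⟩ := NullRec.exists_piS_le_mul hE₁ X x hdens (X.piS_le_of_G_le hNm hC) hR0
  -- This is the block moment bound with A = M/h and π_{s₁}(B) ≤ D h, stripped of its powers of h.
  -- Here C, R and D come from the chain, x and 𝒩_x alone.
  refine ⟨fun q => q.factorial * M.toNNReal ^ q * C ^ (q - 1) * D, ?_⟩
  intro K hKm hK0 hKM hKN E₂ hE₂ W φ₂ hW hWerg gW hgW h hh hh1 hhN k m hk hm l₁ l₂ hl₁ hl₂ j hj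
  obtain ⟨j, rfl⟩ := Nat.exists_eq_add_of_le' hj
  have hKh : Measurable (NullRec.scaled K x h) := NullRec.measurable_scaled hKm x h
  set a : E₁ → ℝ≥0∞ := fun y => ‖NullRec.scaled K x h y‖ₑ
  set b : E₂ → ℝ≥0∞ := fun w => ‖gW w‖ₑ
  have ha : Measurable a := (hKh.comp measurable_subtype_coe).enorm
  have hb : Measurable b := hgW.enorm
  have hg : Measurable fun z : E₁ × E₂ => a z.1 * b z.2 :=
    (ha.comp measurable_fst).mul (hb.comp measurable_snd)
  set q : ℕ := 2 * m * (k + 1) with hqdef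
  obtain ⟨r, hr⟩ : ∃ r, q = r + 1 := Nat.exists_eq_succ_of_ne_zero (by positivity)
  set B : Set E₁ := {y | (y : ℝ) ∈ NullRec.nbhd K x h}
  have hB : MeasurableSet B :=
    (hKh.comp measurable_subtype_coe) (measurableSet_singleton 0).compl
  have hBC : ∀ y, X.G y B ≤ C := fun y => (measure_mono fun z hz => hhN z hz).trans (hC y)
  -- Dilating 𝒩_x(h) about x by the factor 1/h lands in 𝒩_x, which lies within R of x.
  have hBR : ∀ y ∈ B, |(y : ℝ) - x| ≤ h * R := fun y hy => by
    have h1 := hNR (hKN ▸ NullRec.add_div_mem_nbhd_one hy)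
    rw [Metric.mem_closedBall, Real.dist_eq, add_sub_cancel_left, abs_div, abs_of_pos hh,
      div_le_iff₀ hh, mul_comm] at h1
    exact h1
  have hblock : ∫⁻ y, X.blockMoment a q y ∂X.ν ≤
      ((q.factorial * M.toNNReal ^ q * C ^ (q - 1) * D : ℝ≥0) : ℝ≥0∞) *
        ENNReal.ofReal (h ^ (1 - q : ℝ)) := by
    have h1 := X.lintegral_blockMoment_le ha hB
      (NullRec.enorm_scaled_le_indicator hK0 hKM (x : ℝ) hh) hBC r
    rw [← hr] at h1
    refine h1.trans ((mul_le_mul_right (hD B h hB hh (fun y hy => hhN y hy) hBR) _).trans_eq ?_)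
    have hpow : ENNReal.ofReal (h ^ (1 - q : ℝ)) =
        ENNReal.ofReal h⁻¹ ^ q * ENNReal.ofReal h := by
      rw [← ENNReal.ofReal_pow (inv_nonneg.2 hh.le), ← ENNReal.ofReal_mul (by positivity),
        Real.rpow_sub hh, Real.rpow_one, Real.rpow_natCast, inv_pow, div_eq_mul_inv, mul_comm]
    rw [hpow, ENNReal.ofReal_mul (inv_nonneg.2 hh.le), hr, Nat.add_sub_cancel]
    push_cast
    rw [ENNReal.ofNNReal_toNNReal]
    ring
  calc ∫⁻ ω, ‖NullRec.blockSum (fun z : E₁ × E₂ => NullRec.scaled K x h z.1 * gW z.2) (j + 1) ω‖ₑ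
          ^ (2 * m) ∂NullRec.pairLaw X W l₁ l₂
      ≤ ∫⁻ ω, NullRec.blockTsum (NullRec.compoundY ω)
          (NullRec.pairValues (fun z => a z.1 * b z.2) ω) (j + 1) ^ (2 * m)
          ∂NullRec.pairLaw X W l₁ l₂ := by
        refine lintegral_mono fun ω => pow_le_pow_left' ?_ _
        have h1 := NullRec.enorm_blockSum_le
          (fun z : E₁ × E₂ => NullRec.scaled K x h z.1 * gW z.2) (j + 1) ω
        simp only [enorm_mul] at h1
        exact h1
    _ ≤ ∫⁻ ω, NullRec.blockTsum (NullRec.compoundY ω)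
          (NullRec.pairValues (fun z => a z.1 * b z.2) ω) 0 ^ (2 * m)
          ∂NullRec.pairLaw X W X.ν W.ν :=
        NullRec.lintegral_blockTsum_pow_le X W hg (by positivity) j l₁ l₂
    _ ≤ _ := NullRec.lintegral_first_blockTsum_pow_le X W ha hb hm hk
    _ ≤ _ := mul_le_mul_right (ENNReal.rpow_le_rpow (mul_le_mul_right hblock _) (by positivity)) _
    _ = _ := by
        have hk1 : (0 : ℝ) ≤ 1 / (k + 1) := by positivity
        -- The power h^{1-q} enters through Hölder with exponent 1/(k+1), and q/(k+1) = 2m.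
        have hexp : (1 - q : ℝ) * (1 / (k + 1)) = -(2 * m : ℝ) + 1 / (k + 1) := by
          rw [hqdef]
          push_cast
          field_simp
          ring
        rw [ENNReal.mul_rpow_of_nonneg _ _ hk1, ENNReal.mul_rpow_of_nonneg _ _ hk1,
          ENNReal.ofReal_rpow_of_nonneg (by positivity) hk1, ← Real.rpow_mul hh.le, hexp,
          NullRec.momentConst]
        ring
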